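/- Let $M$ be a compact connected complex manifold with a Kähler structure, i.e. a smooth Riemannian metric $G$ such that the complex structure $J$ is $G$-orthogonal and the two-form $\Omega(v,w)=G(Jv,w)$ is closed. For $f\in C^\infty(M,\mathbb R)$ let $X_f$ be the Hamiltonian vector field, determined by $\Omega(X_f,\cdot)=df$, and let $\{f,g\}=\Omega(X_f,X_g)$ be the Poisson bracket. Call $f$ a quasi-symbol if $L_{X_f}G=0$, and let $C^\infty_q(M,\mathbb R)$ be the real vector space of quasi-symbols. Let $H^0(M,T^{1,0}M)$ be the complex vector space of holomorphic vector fields on $M$. Then: 1. $\{\cdot,\cdot\}$ is a Lie bracket on $C^\infty(M,\mathbb R)$, and $C^\infty_q(M,\mathbb R)$ is closed under it, so it is a Lie algebra. 2. There is an $\mathbb R$-linear map $\sigma\colon C^\infty_q(M,\mathbb R)\to H^0(M,T^{1,0}M)$ such that $\operatorname{Re}\sigma(f)=X_f$ for every quasi-symbol $f$, and its kernel consists exactly of the constant functions. 3. $C^\infty_q(M,\mathbb R)$ is finite-dimensional over $\mathbb R$, $h^0(T^{1,0}M)=\dim_{\mathbb C}H^0(M,T^{1,0}M)$ is finite, and $$1\le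 \dim_{\mathbb R} C^\infty_q(M,\mathbb R)\le h^0(T^{1,0}M)+1 .$$ -/

import Mathlib

open scoped Manifold ContDiff Topology Bundle

noncomputable section

namespace Kaehler

variable {E : Type*} [NormedAddCommGroup E] [NormedSpace ℂ E]
  {M : Type*} [TopologicalSpace M] [ChartedSpace E M]

/-- A complex manifold is, through the same charts, a smooth (even analytic) real manifold. -/
instance isManifold_real [IsManifold 𝓘(ℂ, E) ω M] : IsManifold 𝓘(ℝ, E) ω M := by
  apply isManifold_of_contDiffOn
  intro e e' he he'
  have h := (contDiffGroupoid ω 𝓘(ℂ, E)).compatible he he'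
  rw [contDiffGroupoid, mem_groupoid_of_pregroupoid] at h
  have h1 := h.1
  simp only [contDiffPregroupoid] at h1
  exact h1.restrict_scalars ℝ

/-- The complex structure of a complex manifold, acting on the real tangent spaces. A tangent
vector at `x` is represented by an element of `E` in the preferred holomorphic chart at `x`, where
the complex structure is multiplication by `i`. -/
def J (x : M) : TangentSpace 𝓘(ℝ, E) x →L[ℝ] TangentSpace 𝓘(ℝ, E) x :=
  ((Complex.I • ContinuousLinearMap.id ℂ E).restrictScalars ℝ : E →L[ℝ] E)

/-- The differential of a real function, as a family of real linear forms. -/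
def differential (f : M → ℝ) (x : M) : TangentSpace 𝓘(ℝ, E) x →L[ℝ] ℝ :=
  mfderiv 𝓘(ℝ, E) 𝓘(ℝ, ℝ) f x

/-- The derivative `X(f)` of a real function along a real vector field. -/
def dirDeriv (X : Π x : M, TangentSpace 𝓘(ℝ, E) x) (f : M → ℝ) (x : M) : ℝ :=
  differential (E := E) f x (X x)

theorem J_J (x : M) (v : TangentSpace 𝓘(ℝ, E) x) : J x (J x v) = -v := by
  have h : ∀ w : E, Complex.I • (Complex.I • w) = -w := fun w ↦ by
    rw [smul_smul, Complex.I_mul_I, neg_one_smul]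
  exact h v

variable [IsManifold 𝓘(ℂ, E) ω M]

/-- A real vector field is smooth at the point `x`, as a section of the tangent bundle. -/
def SmoothAt (X : Π x : M, TangentSpace 𝓘(ℝ, E) x) (x : M) : Prop :=
  ContMDiffAt 𝓘(ℝ, E) 𝓘(ℝ, E).tangent ∞
    (fun y ↦ (⟨y, X y⟩ : TangentBundle 𝓘(ℝ, E) M)) x

/-- The exterior derivative of a real two-form, evaluated on three vector fields by the invariant
formula
`dΩ(X,Y,Z) = X Ω(Y,Z) + Y Ω(Z,X) + Z Ω(X,Y) - Ω([X,Y],Z) - Ω([Y,Z],X) - Ω([Z,X],Y)`. -/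
def extDerivTwoForm
    (Ω : Π x : M, TangentSpace 𝓘(ℝ, E) x →L[ℝ] TangentSpace 𝓘(ℝ, E) x →L[ℝ] ℝ)
    (X Y Z : Π x : M, TangentSpace 𝓘(ℝ, E) x) (x : M) : ℝ :=
  dirDeriv X (fun y ↦ Ω y (Y y) (Z y)) x + dirDeriv Y (fun y ↦ Ω y (Z y) (X y)) x
    + dirDeriv Z (fun y ↦ Ω y (X y) (Y y)) x
    - Ω x (VectorField.mlieBracket 𝓘(ℝ, E) X Y x) (Z x)
    - Ω x (VectorField.mlieBracket 𝓘(ℝ, E) Y Z x) (X x)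
    - Ω x (VectorField.mlieBracket 𝓘(ℝ, E) Z X x) (Y x)

/-- The Lie derivative of a bilinear form `G` along `X`, evaluated on two vector fields:
`(L_X G)(Y,Z) = X (G(Y,Z)) - G([X,Y],Z) - G(Y,[X,Z])`. -/
def lieDerivBilin
    (G : Π x : M, TangentSpace 𝓘(ℝ, E) x →L[ℝ] TangentSpace 𝓘(ℝ, E) x →L[ℝ] ℝ)
    (X Y Z : Π x : M, TangentSpace 𝓘(ℝ, E) x) (x : M) : ℝ :=
  dirDeriv X (fun y ↦ G y (Y y) (Z y)) x
    - G x (VectorField.mlieBracket 𝓘(ℝ, E) X Y x) (Z x)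
    - G x (Y x) (VectorField.mlieBracket 𝓘(ℝ, E) X Z x)

variable (E M) in
/-- A Kähler structure on a complex manifold: a smooth Riemannian metric `G` for which the complex
structure `J` is orthogonal and whose fundamental form `Ω(v,w) = G(Jv,w)` is closed (so `Ω` is a
symplectic form and `G(v,w) = Ω(v,Jw)`). -/
structure KaehlerStructure where
  /-- The Riemannian metric. -/
  metric : Bundle.ContMDiffRiemannianMetric 𝓘(ℝ, E) ∞ E
    (fun x : M ↦ TangentSpace 𝓘(ℝ, E) x)
  metric_J : ∀ (x : M) (v w : TangentSpace 𝓘(ℝ, E) x),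
    metric.inner x (J x v) (J x w) = metric.inner x v w
  closed : ∀ (x : M) (X Y Z : Π x : M, TangentSpace 𝓘(ℝ, E) x),
    SmoothAt X x → SmoothAt Y x → SmoothAt Z x →
      extDerivTwoForm (fun y ↦ (metric.inner y).comp (J y)) X Y Z x = 0

/-- The smooth real functions on `M`. -/
abbrev SmoothFun (E : Type*) [NormedAddCommGroup E] [NormedSpace ℂ E]
    (M : Type*) [TopologicalSpace M] [ChartedSpace E M] : Type _ :=
  ContMDiffMap 𝓘(ℝ, E) 𝓘(ℝ, ℝ) M ℝ ∞

variable (E M) in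
/-- The complex vector space `H⁰(M, T^{1,0}M)` of holomorphic vector fields: complex differentiable
sections of the holomorphic tangent bundle. Here an element `a` of the fibre, represented in a
holomorphic chart with coordinates `z_j`, stands for the `(1,0)`-vector `∑ a_j ∂/∂z_j`. -/
def HolomorphicVectorField : Submodule ℂ (Π x : M, TangentSpace 𝓘(ℂ, E) x) where
  carrier := {v | MDifferentiable 𝓘(ℂ, E) 𝓘(ℂ, E).tangent
    (fun x ↦ (⟨x, v x⟩ : TangentBundle 𝓘(ℂ, E) M))}
  add_mem' hv hw := mdifferentiable_add_section hv hw
  zero_mem' := Bundle.mdifferentiable_zeroSection ℂ (TangentSpace 𝓘(ℂ, E) (M := M))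
  smul_mem' c _ hv := fun x ↦
    (mdifferentiableAt_const (c := c)).smul_section (hv x)

/-- The real part of a `(1,0)`-vector field. Since `∂/∂z_j = (∂/∂x_j - i ∂/∂y_j) / 2`, the real part
of `∑ a_j ∂/∂z_j` is `(∑ Re a_j ∂/∂x_j + Im a_j ∂/∂y_j) / 2`, which is the real tangent vector
represented in the chart by `a / 2`. -/
def realPart (v : Π x : M, TangentSpace 𝓘(ℂ, E) x) (x : M) : TangentSpace 𝓘(ℝ, E) x :=
  let a : E := v x
  (1 / 2 : ℝ) • a

theorem tangent_coord_J (x y : M) (hy : y ∈ (chartAt E x).source) (v : TangentSpace 𝓘(ℝ, E) y) :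
    (trivializationAt E (TangentSpace 𝓘(ℝ, E)) x ⟨y, J y v⟩).2
      = Complex.I • (trivializationAt E (TangentSpace 𝓘(ℝ, E)) x ⟨y, v⟩).2 := by
  have h := hasFDerivWithinAt_tangentCoordChange (I := 𝓘(ℂ, E)) (x := y) (y := x) (z := y)
    (by simp [hy])
  have h2 := h.restrictScalars ℝ
  simp only [TangentBundle.trivializationAt_apply]
  have h3 := h2.fderivWithin (by
    simp [uniqueDiffWithinAt_univ])
  have key : ∀ w : E, fderivWithin ℝ ((chartAt E x).extend 𝓘(ℝ, E) ∘
      ((chartAt E y).extend 𝓘(ℝ, E)).symm) (Set.range 𝓘(ℝ, E))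
      ((chartAt E y).extend 𝓘(ℝ, E) y) w = tangentCoordChange 𝓘(ℂ, E) y x y w := by
    intro w
    exact congrArg (fun L : E →L[ℝ] E ↦ L w) h3
  have key2 : ∀ w : E, tangentCoordChange 𝓘(ℂ, E) y x y (Complex.I • w)
      = Complex.I • tangentCoordChange 𝓘(ℂ, E) y x y w := fun w ↦ map_smul _ _ _
  exact (key _).trans ((key2 v).trans (congrArg _ (key v).symm))

theorem smoothAt_J {X : Π x : M, TangentSpace 𝓘(ℝ, E) x} {x : M} (hX : SmoothAt X x) :
    SmoothAt (fun y ↦ J y (X y)) x := by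
  rw [SmoothAt] at hX ⊢
  rw [Bundle.contMDiffAt_section] at hX ⊢
  have h2 : ContMDiffAt 𝓘(ℝ, E) 𝓘(ℝ, E) ∞ (fun y ↦ Complex.I •
      (trivializationAt E (TangentSpace 𝓘(ℝ, E)) x ⟨y, X y⟩).2) x :=
    (((Complex.I • ContinuousLinearMap.id ℂ E).restrictScalars ℝ : E →L[ℝ] E).contMDiff
      ).contMDiffAt.comp x hX
  refine h2.congr_of_eventuallyEq ?_
  filter_upwards [(chartAt E x).open_source.mem_nhds (mem_chart_source E x)] with y hy
  exact tangent_coord_J x y hy (X y)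

theorem mdifferentiableAt_of_smoothAt {X : Π x : M, TangentSpace 𝓘(ℝ, E) x} {x : M}
    (hX : SmoothAt X x) : MDifferentiableAt 𝓘(ℝ, E) 𝓘(ℝ, E).tangent
      (fun y ↦ (⟨y, X y⟩ : TangentBundle 𝓘(ℝ, E) M)) x :=
  ContMDiffAt.mdifferentiableAt hX (by simp)

theorem isInvertible_of_pos {V : Type*} [NormedAddCommGroup V] [NormedSpace ℝ V]
    [FiniteDimensional ℝ V] (B : V →L[ℝ] V →L[ℝ] ℝ) (hB : ∀ v, v ≠ 0 → 0 < B v v) :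
    B.IsInvertible := by
  have hinj : Function.Injective B := by
    rw [injective_iff_map_eq_zero]
    intro v hv
    by_contra hne
    have := hB v hne
    rw [hv] at this
    exact lt_irrefl _ this
  have hdim : Module.finrank ℝ V = Module.finrank ℝ (V →L[ℝ] ℝ) := by
    rw [← (LinearMap.toContinuousLinearMap (𝕜 := ℝ) (E := V) (F' := ℝ)).finrank_eq]
    exact (Subspace.dual_finrank_eq (K := ℝ) (V := V)).symm
  exact ⟨(LinearEquiv.ofInjectiveOfFinrankEq B.toLinearMap hinj hdim).toContinuousLinearEquiv,
    by ext; rfl⟩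

namespace KaehlerStructure

variable (K : KaehlerStructure E M)

/-- The symplectic form `Ω(v,w) = G(Jv,w)`. -/
def form (x : M) : TangentSpace 𝓘(ℝ, E) x →L[ℝ] TangentSpace 𝓘(ℝ, E) x →L[ℝ] ℝ :=
  (K.metric.inner x).comp (J x)

variable [FiniteDimensional ℂ E]

theorem exists_grad (x : M) (α : TangentSpace 𝓘(ℝ, E) x →L[ℝ] ℝ) :
    ∃ v : TangentSpace 𝓘(ℝ, E) x, ∀ w, K.metric.inner x v w = α w := by
  obtain ⟨v, hv⟩ := (isInvertible_of_pos (V := E) (K.metric.inner x) (K.metric.pos x)).surjective α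
  exact ⟨v, fun w ↦ congrArg (fun L : E →L[ℝ] ℝ ↦ L w) hv⟩

theorem existsUnique_form (x : M) (α : TangentSpace 𝓘(ℝ, E) x →L[ℝ] ℝ) :
    ∃! v : TangentSpace 𝓘(ℝ, E) x, ∀ w, K.form x v w = α w := by
  obtain ⟨u, hu⟩ := K.exists_grad x α
  have hJ : J x (-J x u) = u := by rw [map_neg, J_J, neg_neg]
  refine ⟨-J x u, fun w ↦ ?_, fun v hv ↦ ?_⟩
  · change K.metric.inner x (J x (-J x u)) w = α w
    rw [hJ, hu]
  · have h : J x v = u := by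
      rw [← sub_eq_zero]
      by_contra hne
      have hp := K.metric.pos x _ hne
      have h1 : K.metric.inner x (J x v) (J x v - u) = α (J x v - u) := hv _
      rw [map_sub, K.metric.symm, h1, K.metric.symm, hu, sub_self] at hp
      exact lt_irrefl _ hp
    rw [← h, J_J, neg_neg]

/-- The Hamiltonian vector field `X_f`, the unique vector field with `Ω(X_f, ·) = df`. -/
def hamiltonianField (f : M → ℝ) (x : M) : TangentSpace 𝓘(ℝ, E) x :=
  (K.existsUnique_form x (differential f x)).choose

theorem form_hamiltonianField (f : M → ℝ) (x : M) (w : TangentSpace 𝓘(ℝ, E) x) :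
    K.form x (K.hamiltonianField f x) w = differential f x w :=
  (K.existsUnique_form x (differential f x)).choose_spec.1 w

theorem smoothAt_of_metric_eq (f : SmoothFun E M) (U : Π x : M, TangentSpace 𝓘(ℝ, E) x)
    (hU : ∀ y w, K.metric.inner y (U y) w = differential f y w) (x : M) : SmoothAt U x := by
  have hG := (contMDiffAt_hom_bundle _).1 (K.metric.contMDiff x)
  have hf := ((f.contMDiff x).mfderiv_const (m := ∞) (by simp))
  have hG2 := hG.2
  set A : M → E →L[ℝ] E →L[ℝ] ℝ := fun y ↦ ContinuousLinearMap.inCoordinates E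
    (TangentSpace 𝓘(ℝ, E)) (E →L[ℝ] ℝ) (fun y : M ↦ TangentSpace 𝓘(ℝ, E) y →L[ℝ] ℝ)
    x y x y (K.metric.inner y) with hA
  set α : M → E →L[ℝ] ℝ :=
    inTangentCoordinates 𝓘(ℝ, E) 𝓘(ℝ, ℝ) id f (mfderiv 𝓘(ℝ, E) 𝓘(ℝ, ℝ) f) x with hα
  have hA' : ContMDiffAt 𝓘(ℝ, E) 𝓘(ℝ, E →L[ℝ] E →L[ℝ] ℝ) ∞ A x := hG2
  let T := trivializationAt E (TangentSpace 𝓘(ℝ, E) (M := M)) x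
  have hAy : ∀ y ∈ (chartAt E x).source, ∀ a b : E,
      A y a b = K.metric.inner y (T.symmL ℝ y a) (T.symmL ℝ y b) := by
    intro y hy a b
    refine (inCoordinates_apply_eq₂ (F₁ := E) (F₂ := E) (F₃ := ℝ)
      (E₁ := TangentSpace 𝓘(ℝ, E) (M := M))
      (E₂ := TangentSpace 𝓘(ℝ, E) (M := M)) (E₃ := Bundle.Trivial M ℝ) (x₀ := x) (x := y)
      (ϕ := K.metric.inner y) (v := a) (w := b) hy hy (Set.mem_univ y)).trans ?_
    rw [T.symmL_apply (b := y) hy, T.symmL_apply (b := y) hy]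
    simp [T]
  have hαy : ∀ y ∈ (chartAt E x).source, ∀ b : E,
      α y b = differential f y (T.symmL ℝ y b) := by
    intro y hy b
    have h : ∀ c : ℝ, (trivializationAt ℝ (TangentSpace 𝓘(ℝ, ℝ)) (f x)).continuousLinearMapAt ℝ
        (f y) c = c := fun c ↦ by
      rw [TangentBundle.continuousLinearMapAt_model_space]
      rfl
    exact h _
  let u : M → E := fun y ↦ (T ⟨y, U y⟩).2
  have hu : ∀ y ∈ (chartAt E x).source, T.symmL ℝ y (u y) = U y := fun y hy ↦
    by
    rw [T.symmL_apply (b := y) hy]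
    exact T.symm_apply_apply_mk (b := y) hy (U y)
  have hTne : ∀ y ∈ (chartAt E x).source, ∀ a : E, a ≠ 0 → T.symmL ℝ y a ≠ 0 := by
    intro y hy a ha h0
    apply ha
    have h1 := T.continuousLinearMapAt_symmL (R := ℝ) (b := y) hy a
    rw [h0, map_zero] at h1
    exact h1.symm
  have hinv : ∀ y ∈ (chartAt E x).source, (A y).IsInvertible := by
    intro y hy
    refine isInvertible_of_pos _ fun a ha ↦ ?_
    rw [hAy y hy]
    exact K.metric.pos y _ (hTne y hy a ha)
  have hsol : ∀ y ∈ (chartAt E x).source, u y = (A y).inverse (α y) := by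
    intro y hy
    have h1 : A y (u y) = α y := by
      ext b
      rw [hAy y hy, hαy y hy, hu y hy, hU]
    rw [← h1, (hinv y hy).inverse_apply_self]
  have hx := mem_chart_source E x
  rw [SmoothAt, Bundle.contMDiffAt_section]
  have hsm : ContMDiffAt 𝓘(ℝ, E) 𝓘(ℝ, E) ∞ (fun y ↦ (A y).inverse (α y)) x := by
    refine ContMDiffAt.clm_apply ?_ hf
    exact ((hinv x hx).contDiffAt_map_inverse (n := ∞)).contMDiffAt.comp x hA'
  refine hsm.congr_of_eventuallyEq ?_
  filter_upwards [(chartAt E x).open_source.mem_nhds hx] with y hy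
  exact hsol y hy

theorem smoothAt_hamiltonianField (f : SmoothFun E M) (x : M) :
    SmoothAt (K.hamiltonianField f) x := by
  have h := smoothAt_J (K.smoothAt_of_metric_eq f (fun y ↦ J y (K.hamiltonianField f y))
    (fun y w ↦ K.form_hamiltonianField f y w) x)
  simp only [J_J] at h
  have h2 := ContMDiffAt.neg_section h
  have h3 : -(fun y ↦ -K.hamiltonianField (E := E) f y) = K.hamiltonianField f := by
    funext y
    exact neg_neg _
  rw [h3] at h2
  exact h2

/-- A function is a quasi-symbol if its Hamiltonian vector field is a Killing field, that is,
`L_{X_f} G = 0`. -/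
def IsQuasiSymbol (f : SmoothFun E M) : Prop :=
  ∀ (x : M) (Y Z : Π x : M, TangentSpace 𝓘(ℝ, E) x), SmoothAt Y x → SmoothAt Z x →
    lieDerivBilin K.metric.inner (K.hamiltonianField f) Y Z x = 0

theorem eq_hamiltonianField {f : M → ℝ} {x : M} {v : TangentSpace 𝓘(ℝ, E) x}
    (hv : ∀ w, K.form x v w = differential f x w) : v = K.hamiltonianField f x :=
  (K.existsUnique_form x (differential f x)).unique hv (K.form_hamiltonianField f x)

theorem hamiltonianField_add (f g : SmoothFun E M) :
    K.hamiltonianField (f + g : SmoothFun E M) =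
      K.hamiltonianField (E := E) f + K.hamiltonianField (E := E) g := by
  funext x
  symm
  apply K.eq_hamiltonianField
  intro w
  have h : differential (E := E) (f + g : SmoothFun E M) x
      = differential f x + differential g x :=
    mfderiv_add f.mdifferentiableAt g.mdifferentiableAt
  rw [h, Pi.add_apply, map_add]
  change K.form x _ w + K.form x _ w = differential (E := E) f x w + differential (E := E) g x w
  rw [K.form_hamiltonianField, K.form_hamiltonianField]

theorem hamiltonianField_smul (c : ℝ) (f : SmoothFun E M) :
    K.hamiltonianField (c • f : SmoothFun E M) = c • K.hamiltonianField (E := E) f := by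
  funext x
  symm
  apply K.eq_hamiltonianField
  intro w
  have h : differential (E := E) (c • f : SmoothFun E M) x = c • differential f x :=
    const_smul_mfderiv f.mdifferentiableAt c
  rw [h, Pi.smul_apply, map_smul]
  change c • K.form x _ w = c • differential (E := E) f x w
  rw [K.form_hamiltonianField]

theorem hamiltonianField_zero : K.hamiltonianField (0 : SmoothFun E M) = 0 := by
  have h := K.hamiltonianField_smul 0 0
  rwa [zero_smul, zero_smul] at h

/-- The real vector space `C^∞_q(M, ℝ)` of quasi-symbols. -/
def quasiSymbols : Submodule ℝ (SmoothFun E M) where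
  carrier := {f | K.IsQuasiSymbol f}
  add_mem' {f g} hf hg x Y Z hY hZ := by
    have h1 := hf x Y Z hY hZ
    have h2 := hg x Y Z hY hZ
    have df := mdifferentiableAt_of_smoothAt (K.smoothAt_hamiltonianField f x)
    have dg := mdifferentiableAt_of_smoothAt (K.smoothAt_hamiltonianField g x)
    rw [hamiltonianField_add]
    simp only [lieDerivBilin, dirDeriv] at h1 h2 ⊢
    rw [VectorField.mlieBracket_add_left df dg, VectorField.mlieBracket_add_left df dg]
    rw [Pi.add_apply, map_add, map_add, map_add, add_apply]
    linarith
  zero_mem' x Y Z hY hZ := by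
    rw [hamiltonianField_zero]
    simp [lieDerivBilin, dirDeriv, VectorField.mlieBracket_zero_left]
  smul_mem' c f hf x Y Z hY hZ := by
    have h1 := hf x Y Z hY hZ
    have df := mdifferentiableAt_of_smoothAt (K.smoothAt_hamiltonianField f x)
    rw [hamiltonianField_smul]
    simp only [lieDerivBilin, dirDeriv] at h1 ⊢
    rw [VectorField.mlieBracket_const_smul_left df, VectorField.mlieBracket_const_smul_left df]
    rw [Pi.smul_apply, map_smul, map_smul, map_smul, smul_apply, ← smul_sub, ← smul_sub, h1,
      smul_zero]

theorem contMDiff_poisson (f g : SmoothFun E M) : ContMDiff 𝓘(ℝ, E) 𝓘(ℝ, ℝ) ∞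
    (fun x ↦ K.form x (K.hamiltonianField f x) (K.hamiltonianField g x)) := by
  intro x
  have h : ContMDiffAt 𝓘(ℝ, E) (𝓘(ℝ, E).prod 𝓘(ℝ)) ∞
      (fun m ↦ Bundle.TotalSpace.mk' ℝ (E := Bundle.Trivial M ℝ) m
        (K.metric.inner m (J m (K.hamiltonianField f m)) (K.hamiltonianField g m))) x := by
    apply ContMDiffAt.clm_bundle_apply₂ (F₁ := E) (F₂ := E)
    · exact K.metric.contMDiff x
    · exact smoothAt_J (K.smoothAt_hamiltonianField f x)
    · exact K.smoothAt_hamiltonianField g x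
  simp only [Bundle.contMDiffAt_totalSpace] at h
  exact h.2

/-- The Poisson bracket `{f,g} = Ω(X_f, X_g)`, a bilinear operation on smooth functions. -/
def poisson : SmoothFun E M →ₗ[ℝ] SmoothFun E M →ₗ[ℝ] SmoothFun E M :=
  LinearMap.mk₂ ℝ
    (fun f g ↦ ⟨fun x ↦ K.form x (K.hamiltonianField f x) (K.hamiltonianField g x),
      K.contMDiff_poisson f g⟩)
    (fun f₁ f₂ g ↦ by
      ext x
      change K.form x _ _ = K.form x _ _ + K.form x _ _
      rw [hamiltonianField_add, Pi.add_apply, map_add, add_apply])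
    (fun c f g ↦ by
      ext x
      change K.form x _ _ = c • K.form x _ _
      rw [hamiltonianField_smul, Pi.smul_apply, map_smul, smul_apply])
    (fun f g₁ g₂ ↦ by
      ext x
      change K.form x _ _ = K.form x _ _ + K.form x _ _
      rw [hamiltonianField_add, Pi.add_apply, map_add])
    (fun c f g ↦ by
      ext x
      change K.form x _ _ = c • K.form x _ _
      rw [hamiltonianField_smul, Pi.smul_apply, map_smul])

end KaehlerStructure
end Kaehler

end

open scoped Manifold ContDiff Topology Bundle

noncomputable section

namespace Kaehler

variable {E : Type*} [NormedAddCommGroup E] [NormedSpace ℂ E]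
  {M : Type*} [TopologicalSpace M] [ChartedSpace E M]

/-! The link between symplectic and complex geometry is that a Hamiltonian field preserves `Ω`
(closedness, `dirDeriv_form`), so it preserves `G` exactly when it preserves `J`. In a holomorphic
chart `J` is multiplication by the constant `i`, and `L_X J = 0` says that the derivative of `X` is
complex linear (`CommutesJ`), i.e. `X` is holomorphic. This gives `σ(f)`, which is `2 X_f` in
coordinates. Fields preserving `J` are closed under brackets by the Jacobi identity, and `X_{{f,g}}
= -[X_f, X_g]` (`hamiltonianField_poisson`), so quasi-symbols are closed under the Poisson bracket.

Finiteness of `h⁰` comes from the Schwarz lemma: a holomorphic field vanishing at enough points has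
maximal length at most half of itself, so evaluation at finitely many points is injective.

For the upper bound, the image of `σ` is totally real. If `σ(f) = i σ(g)`, then `X_f = J X_g` is the
gradient of `g` and is Killing, which forces constant length; it vanishes where `g` is maximal,
hence everywhere. So the image has real dimension at most `h⁰`, and the kernel, the constants, adds
one. -/

/-- The coordinates of a real vector field in the tangent trivialization at `x`. -/
def coord (X : Π x : M, TangentSpace 𝓘(ℝ, E) x) [IsManifold 𝓘(ℝ, E) 1 M] (x y : M) : E :=
  (trivializationAt E (TangentSpace 𝓘(ℝ, E)) x ⟨y, X y⟩).2

/-- A real vector field read in the preferred chart at `x`. -/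
def chartField (X : Π x : M, TangentSpace 𝓘(ℝ, E) x) [IsManifold 𝓘(ℝ, E) 1 M] (x : M) (z : E) : E :=
  coord X x ((extChartAt 𝓘(ℝ, E) x).symm z)

/-! ### Vector fields, brackets and derivatives in a chart. -/

section Chart

variable [IsManifold 𝓘(ℂ, E) ω M]

theorem inverse_apply_apply {A : E →L[ℝ] E} (hA : A.IsInvertible) (v : E) : A.inverse (A v) = v :=
  hA.inverse_apply_self v

variable {X Y Z : Π x : M, TangentSpace 𝓘(ℝ, E) x} {x y : M}

/-- Differentiability of a real vector field at a point. -/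
abbrev MDiffField (X : Π x : M, TangentSpace 𝓘(ℝ, E) x) (x : M) : Prop :=
  MDifferentiableAt 𝓘(ℝ, E) 𝓘(ℝ, E).tangent
    (fun y ↦ (⟨y, X y⟩ : TangentBundle 𝓘(ℝ, E) M)) x

theorem coord_self : coord X x x = X x := by
  have h := mem_chart_source E x
  rw [coord, TangentBundle.trivializationAt_apply]
  have := tangentCoordChange_self (I := 𝓘(ℝ, E)) (x := x) (z := x) (v := X x) (by simp)
  exact this

theorem coord_eq_continuousLinearMapAt (hy : y ∈ (chartAt E x).source) :
    coord X x y = (trivializationAt E (TangentSpace 𝓘(ℝ, E)) x).continuousLinearMapAt ℝ y (X y) := by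
  have := (trivializationAt E (TangentSpace 𝓘(ℝ, E)) x).continuousLinearMapAt_apply_of_mem
    (R := ℝ) (b := y) hy (X y)
  exact this.symm

theorem symmL_coord (hy : y ∈ (chartAt E x).source) :
    (trivializationAt E (TangentSpace 𝓘(ℝ, E)) x).symmL ℝ y (coord X x y) = X y := by
  rw [coord_eq_continuousLinearMapAt hy]
  exact (trivializationAt E (TangentSpace 𝓘(ℝ, E)) x).symmL_continuousLinearMapAt (R := ℝ)
    (b := y) hy (X y)

theorem coord_J (hy : y ∈ (chartAt E x).source) :
    coord (fun y ↦ J y (X y)) x y = Complex.I • coord X x y :=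
  tangent_coord_J x y hy (X y)

omit [IsManifold 𝓘(ℂ, E) ω M] in
theorem symm_mem_source {z : E} (hz : z ∈ (chartAt E x).target) :
    (extChartAt 𝓘(ℝ, E) x).symm z ∈ (chartAt E x).source := by
  simpa using (chartAt E x).map_target hz

omit [IsManifold 𝓘(ℂ, E) ω M] in
theorem target_mem_nhds : (chartAt E x).target ∈ 𝓝 (extChartAt 𝓘(ℝ, E) x x) := by
  simpa using (chartAt E x).open_target.mem_nhds (mem_chart_target E x)

/-- The manifold bracket is defined by pulling fields back along the inverse chart; this identifies
the pullback with trivialization coordinates. -/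
theorem mpullbackWithin_eq_chartField {z : E} (hz : z ∈ (chartAt E x).target) :
    VectorField.mpullbackWithin 𝓘(ℝ, E) 𝓘(ℝ, E) (extChartAt 𝓘(ℝ, E) x).symm X
      (Set.range 𝓘(ℝ, E)) z = chartField X x z := by
  have hs := symm_mem_source hz
  have hz' : extChartAt 𝓘(ℝ, E) x ((extChartAt 𝓘(ℝ, E) x).symm z) = z :=
    (extChartAt 𝓘(ℝ, E) x).right_inv (by simpa using hz)
  rw [VectorField.mpullbackWithin_apply]
  have h1 := TangentBundle.symmL_trivializationAt (I := 𝓘(ℝ, E)) hs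
  rw [hz'] at h1
  have hinv : (mfderivWithin 𝓘(ℝ, E) 𝓘(ℝ, E) (extChartAt 𝓘(ℝ, E) x).symm
      (Set.range 𝓘(ℝ, E)) z).IsInvertible :=
    isInvertible_mfderivWithin_extChartAt_symm (by simpa using hz)
  have h2 : X ((extChartAt 𝓘(ℝ, E) x).symm z) = mfderivWithin 𝓘(ℝ, E) 𝓘(ℝ, E)
      (extChartAt 𝓘(ℝ, E) x).symm (Set.range 𝓘(ℝ, E)) z (chartField X x z : E) := by
    rw [← h1]
    exact (symmL_coord hs).symm
  rw [h2]
  exact inverse_apply_apply (E := E) hinv (chartField X x z)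

theorem mdiffField_iff :
    MDiffField X x ↔ DifferentiableAt ℝ (chartField X x) (extChartAt 𝓘(ℝ, E) x x) := by
  rw [MDiffField, mdifferentiableAt_section]
  change MDifferentiableAt 𝓘(ℝ, E) 𝓘(ℝ, E) (coord X x) x ↔ _
  have hw : writtenInExtChartAt 𝓘(ℝ, E) 𝓘(ℝ, E) x (coord X x) = chartField X x := rfl
  rw [mdifferentiableAt_iff, hw, ModelWithCorners.range_eq_univ, differentiableWithinAt_univ]
  refine and_iff_right_of_imp fun h ↦ ?_
  have h2 : ContinuousAt ((chartField X x) ∘ extChartAt 𝓘(ℝ, E) x) x :=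
    h.continuousAt.comp (continuousAt_extChartAt x)
  refine h2.congr ?_
  filter_upwards [extChartAt_source_mem_nhds (I := 𝓘(ℝ, E)) x] with y hy
  simp only [Function.comp, chartField, (extChartAt 𝓘(ℝ, E) x).left_inv hy]

theorem mlieBracket_eq_lieBracket :
    VectorField.mlieBracket 𝓘(ℝ, E) X Y x =
      VectorField.lieBracket ℝ (chartField X x) (chartField Y x) (extChartAt 𝓘(ℝ, E) x x) := by
  rw [← VectorField.mlieBracketWithin_univ, VectorField.mlieBracketWithin_apply]
  have h1 := TangentBundle.continuousLinearMapAt_trivializationAt (I := 𝓘(ℝ, E))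
    (mem_chart_source E x)
  have hX : VectorField.mpullbackWithin 𝓘(ℝ, E) 𝓘(ℝ, E) (extChartAt 𝓘(ℝ, E) x).symm X
      (Set.range 𝓘(ℝ, E)) =ᶠ[𝓝 (extChartAt 𝓘(ℝ, E) x x)] chartField X x := by
    filter_upwards [target_mem_nhds] with z hz using mpullbackWithin_eq_chartField hz
  have hY : VectorField.mpullbackWithin 𝓘(ℝ, E) 𝓘(ℝ, E) (extChartAt 𝓘(ℝ, E) x).symm Y
      (Set.range 𝓘(ℝ, E)) =ᶠ[𝓝 (extChartAt 𝓘(ℝ, E) x x)] chartField Y x := by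
    filter_upwards [target_mem_nhds] with z hz using mpullbackWithin_eq_chartField hz
  have h2 : VectorField.lieBracketWithin ℝ
      (VectorField.mpullbackWithin 𝓘(ℝ, E) 𝓘(ℝ, E) (extChartAt 𝓘(ℝ, E) x).symm X
        (Set.range 𝓘(ℝ, E)))
      (VectorField.mpullbackWithin 𝓘(ℝ, E) 𝓘(ℝ, E) (extChartAt 𝓘(ℝ, E) x).symm Y
        (Set.range 𝓘(ℝ, E)))
      ((extChartAt 𝓘(ℝ, E) x).symm ⁻¹' Set.univ ∩ Set.range 𝓘(ℝ, E)) (extChartAt 𝓘(ℝ, E) x x)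
      = VectorField.lieBracket ℝ (chartField X x) (chartField Y x) (extChartAt 𝓘(ℝ, E) x x) := by
    rw [← hX.lieBracket_vectorField_eq hY, ModelWithCorners.range_eq_univ, Set.preimage_univ,
      Set.inter_univ]
    exact congrFun VectorField.lieBracketWithin_univ _
  rw [h2]
  have hinv := isInvertible_mfderiv_extChartAt (I := 𝓘(ℝ, E)) (mem_extChartAt_source (I := 𝓘(ℝ, E)) x)
  -- The derivative of the preferred chart at its own centre is the identity, so transporting the
  -- bracket back to `x` changes nothing.
  have h3 : ∀ v : E, mfderiv 𝓘(ℝ, E) 𝓘(ℝ, E) (extChartAt 𝓘(ℝ, E) x) x v = v := by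
    intro v
    rw [← h1]
    let V : Π y : M, TangentSpace 𝓘(ℝ, E) y := fun y ↦ v
    have h := coord_eq_continuousLinearMapAt (X := V) (mem_chart_source E x)
    exact h.symm.trans coord_self
  generalize VectorField.lieBracket ℝ (chartField X x) (chartField Y x)
    (extChartAt 𝓘(ℝ, E) x x) = v
  have h4 := inverse_apply_apply (E := E) hinv v
  exact (congrArg _ (h3 v).symm).trans h4

theorem dirDeriv_eq_fderiv {f : M → ℝ} (hf : MDifferentiableAt 𝓘(ℝ, E) 𝓘(ℝ, ℝ) f y)
    (hy : y ∈ (chartAt E x).source) :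
    dirDeriv X f y = fderiv ℝ (f ∘ (extChartAt 𝓘(ℝ, E) x).symm) (extChartAt 𝓘(ℝ, E) x y)
      (coord X x y) := by
  have hy' : y ∈ (extChartAt 𝓘(ℝ, E) x).source := by simpa using hy
  have h1 := TangentBundle.symmL_trivializationAt (I := 𝓘(ℝ, E)) hy
  have hl := (extChartAt 𝓘(ℝ, E) x).left_inv hy'
  have hd : MDifferentiableAt 𝓘(ℝ, E) 𝓘(ℝ, E) (extChartAt 𝓘(ℝ, E) x).symm
      (extChartAt 𝓘(ℝ, E) x y) := by
    have := mdifferentiableWithinAt_extChartAt_symm (I := 𝓘(ℝ, E))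
      ((extChartAt 𝓘(ℝ, E) x).map_source hy')
    simpa [mdifferentiableWithinAt_univ] using this
  have hf' : MDifferentiableAt 𝓘(ℝ, E) 𝓘(ℝ, ℝ) f
      ((extChartAt 𝓘(ℝ, E) x).symm (extChartAt 𝓘(ℝ, E) x y)) := by rwa [hl]
  have hc := mfderiv_comp (extChartAt 𝓘(ℝ, E) x y) hf' hd
  rw [← mfderiv_eq_fderiv]
  have h5 : mfderiv 𝓘(ℝ, E) 𝓘(ℝ, E) (extChartAt 𝓘(ℝ, E) x).symm (extChartAt 𝓘(ℝ, E) x y)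
      (coord X x y : E) = X y := by
    have h6 := symmL_coord (X := X) hy
    rw [h1] at h6
    rw [ModelWithCorners.range_eq_univ, mfderivWithin_univ] at h6
    exact h6
  have h8 : ∀ v : E, mfderiv 𝓘(ℝ, E) 𝓘(ℝ, ℝ) (f ∘ (extChartAt 𝓘(ℝ, E) x).symm)
      (extChartAt 𝓘(ℝ, E) x y) v = mfderiv 𝓘(ℝ, E) 𝓘(ℝ, ℝ) f
      ((extChartAt 𝓘(ℝ, E) x).symm (extChartAt 𝓘(ℝ, E) x y)) (mfderiv 𝓘(ℝ, E) 𝓘(ℝ, E)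
        (extChartAt 𝓘(ℝ, E) x).symm (extChartAt 𝓘(ℝ, E) x y) v) := by
    intro v
    rw [hc]
    rfl
  -- The chain rule differentiates `f` at the image of `y` under the chart and its inverse, a point
  -- only propositionally equal to `y`.
  have h9 : ∀ (w : M) (hw : w = y) (v : E), mfderiv 𝓘(ℝ, E) 𝓘(ℝ, ℝ) f w v
      = mfderiv 𝓘(ℝ, E) 𝓘(ℝ, ℝ) f y v := by
    rintro w rfl v
    rfl
  refine Eq.symm ((h8 _).trans ((h9 _ hl _).trans ?_))
  exact congrArg (mfderiv 𝓘(ℝ, E) 𝓘(ℝ, ℝ) f y) h5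

end Chart

/-! ### Commutators, and fields preserving the complex structure. -/

section Fields

variable [IsManifold 𝓘(ℂ, E) ω M] {X Y Z : Π x : M, TangentSpace 𝓘(ℝ, E) x} {x y : M}

omit [IsManifold 𝓘(ℂ, E) ω M] in
theorem mdifferentiableAt_of_chart {g : M → ℝ}
    (hg : DifferentiableAt ℝ (g ∘ (extChartAt 𝓘(ℝ, E) x).symm) (extChartAt 𝓘(ℝ, E) x x)) :
    MDifferentiableAt 𝓘(ℝ, E) 𝓘(ℝ, ℝ) g x := by
  have hw : writtenInExtChartAt 𝓘(ℝ, E) 𝓘(ℝ, ℝ) x g = g ∘ (extChartAt 𝓘(ℝ, E) x).symm := rfl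
  rw [mdifferentiableAt_iff, hw, ModelWithCorners.range_eq_univ, differentiableWithinAt_univ]
  refine ⟨?_, hg⟩
  have h2 : ContinuousAt ((g ∘ (extChartAt 𝓘(ℝ, E) x).symm) ∘ extChartAt 𝓘(ℝ, E) x) x :=
    hg.continuousAt.comp (continuousAt_extChartAt x)
  refine h2.congr ?_
  filter_upwards [extChartAt_source_mem_nhds (I := 𝓘(ℝ, E)) x] with y hy
  simp only [Function.comp, (extChartAt 𝓘(ℝ, E) x).left_inv hy]

omit [IsManifold 𝓘(ℂ, E) ω M] in
theorem contDiffAt_chart {f : M → ℝ} {n : WithTop ℕ∞} (hf : ContMDiffAt 𝓘(ℝ, E) 𝓘(ℝ, ℝ) n f x) :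
    ContDiffAt ℝ n (f ∘ (extChartAt 𝓘(ℝ, E) x).symm) (extChartAt 𝓘(ℝ, E) x x) := by
  have h := (contMDiffAt_iff.1 hf).2
  rw [ModelWithCorners.range_eq_univ, contDiffWithinAt_univ] at h
  exact h

theorem chartField_self : chartField X x (extChartAt 𝓘(ℝ, E) x x) = X x := by
  rw [chartField, extChartAt_to_inv, coord_self]

theorem coord_comp_extChartAt (hy : y ∈ (chartAt E x).source) :
    chartField X x (extChartAt 𝓘(ℝ, E) x y) = coord X x y := by
  rw [chartField, (extChartAt 𝓘(ℝ, E) x).left_inv (by simpa using hy)]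

theorem dirDeriv_comp_symm_eventuallyEq {f : M → ℝ} (hf : ContMDiffAt 𝓘(ℝ, E) 𝓘(ℝ, ℝ) 2 f x)
    (X : Π x : M, TangentSpace 𝓘(ℝ, E) x) :
    dirDeriv X f ∘ (extChartAt 𝓘(ℝ, E) x).symm =ᶠ[𝓝 (extChartAt 𝓘(ℝ, E) x x)]
      fun z ↦ fderiv ℝ (f ∘ (extChartAt 𝓘(ℝ, E) x).symm) z (chartField X x z) := by
  have h1 : ∀ᶠ y in 𝓝 x, MDifferentiableAt 𝓘(ℝ, E) 𝓘(ℝ, ℝ) f y := by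
    filter_upwards [(contMDiffAt_iff_contMDiffAt_nhds (by simp)).1 hf] with y hy using hy.mdifferentiableAt (by simp)
  have h2 : Filter.Tendsto (extChartAt 𝓘(ℝ, E) x).symm (𝓝 (extChartAt 𝓘(ℝ, E) x x)) (𝓝 x) := by
    have := continuousAt_extChartAt_symm (I := 𝓘(ℝ, E)) x
    rwa [ContinuousAt, extChartAt_to_inv] at this
  filter_upwards [h2.eventually h1, target_mem_nhds (x := x)] with z hz hzt
  have hr := (extChartAt 𝓘(ℝ, E) x).right_inv (x := z) (by simpa using hzt)
  rw [Function.comp_apply, dirDeriv_eq_fderiv hz (symm_mem_source hzt), hr]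
  rfl

theorem mdifferentiableAt_dirDeriv {f : M → ℝ} (hf : ContMDiffAt 𝓘(ℝ, E) 𝓘(ℝ, ℝ) 2 f x)
    (hX : MDiffField X x) : MDifferentiableAt 𝓘(ℝ, E) 𝓘(ℝ, ℝ) (dirDeriv X f) x := by
  apply mdifferentiableAt_of_chart
  rw [(dirDeriv_comp_symm_eventuallyEq hf X).differentiableAt_iff]
  have h := (contDiffAt_chart hf).fderiv_right (m := 1) (by norm_num)
  exact (h.differentiableAt (by simp)).clm_apply (mdiffField_iff.1 hX)

/-- The Lie bracket acts on functions as the commutator of directional derivatives. -/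
theorem dirDeriv_mlieBracket {f : M → ℝ} (hf : ContMDiffAt 𝓘(ℝ, E) 𝓘(ℝ, ℝ) 2 f x)
    (hX : MDiffField X x) (hY : MDiffField Y x) :
    dirDeriv (VectorField.mlieBracket 𝓘(ℝ, E) X Y) f x
      = dirDeriv X (dirDeriv Y f) x - dirDeriv Y (dirDeriv X f) x := by
  have hx := mem_chart_source E x
  rw [dirDeriv_eq_fderiv (hf.mdifferentiableAt (by simp)) hx,
    dirDeriv_eq_fderiv (mdifferentiableAt_dirDeriv hf hY) hx,
    dirDeriv_eq_fderiv (mdifferentiableAt_dirDeriv hf hX) hx,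
    (dirDeriv_comp_symm_eventuallyEq hf X).fderiv_eq,
    (dirDeriv_comp_symm_eventuallyEq hf Y).fderiv_eq, coord_self,
    ← coord_comp_extChartAt (X := X) hx, ← coord_comp_extChartAt (X := Y) hx,
    mlieBracket_eq_lieBracket]
  exact VectorField.fderiv_apply_lieBracket (contDiffAt_chart hf) (by simp)
    (mdiffField_iff.1 hY) (mdiffField_iff.1 hX)

/-- Turns identities between fields into identities between vectors: every tangent vector is the
value of a field smooth at its base point. -/
theorem smoothAt_extend (v : TangentSpace 𝓘(ℝ, E) x) : SmoothAt (FiberBundle.extend E v) x :=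
  FiberBundle.contMDiffAt_extend ..

theorem smoothAt_mlieBracket [CompleteSpace E] (hX : SmoothAt X x) (hY : SmoothAt Y x) :
    SmoothAt (VectorField.mlieBracket 𝓘(ℝ, E) X Y) x :=
  ContMDiffAt.mlieBracket_vectorField (m := ⊤) (n := ⊤) hX hY (by simp)

/-- The derivative, in the preferred chart at `x`, of a real vector field. -/
def chartDeriv (X : Π x : M, TangentSpace 𝓘(ℝ, E) x) (x : M) : E →L[ℝ] E :=
  fderiv ℝ (chartField X x) (extChartAt 𝓘(ℝ, E) x x)

/-- The derivative of `X` in the chart at `x` is complex linear: the coordinate form of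
`L_X J = 0` at `x`. -/
def CommutesJ (X : Π x : M, TangentSpace 𝓘(ℝ, E) x) (x : M) : Prop :=
  ∀ v : E, chartDeriv X x (Complex.I • v) = Complex.I • chartDeriv X x v

theorem mlieBracket_eq_chartDeriv : VectorField.mlieBracket 𝓘(ℝ, E) X Y x =
    (chartDeriv Y x (X x) - chartDeriv X x (Y x) : E) := by
  rw [mlieBracket_eq_lieBracket, VectorField.lieBracket, chartField_self, chartField_self]
  rfl

theorem mlieBracket_self : VectorField.mlieBracket 𝓘(ℝ, E) X X x = 0 := by
  rw [mlieBracket_eq_chartDeriv]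
  exact sub_self (G := E) _

theorem chartDeriv_J (hX : MDiffField X x) (v : E) :
    chartDeriv (fun y ↦ J y (X y)) x v = Complex.I • chartDeriv X x v := by
  have h : chartField (fun y ↦ J y (X y)) x =ᶠ[𝓝 (extChartAt 𝓘(ℝ, E) x x)]
      fun z ↦ Complex.I • chartField X x z := by
    filter_upwards [target_mem_nhds (x := x)] with z hz
    exact coord_J (symm_mem_source hz)
  rw [chartDeriv, h.fderiv_eq, fderiv_fun_const_smul (mdiffField_iff.1 hX)]
  rfl

/-- In the chart, `[X, JY]` is `i DY(X) - DX(iY)` and `J[X, Y]` is `i DY(X) - i DX(Y)`. The terms in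
`DY` cancel, so only the value of `Y` at `x` matters. -/
theorem mlieBracket_J_eq_iff (hY : MDiffField Y x) {v : E} (hv : v = Y x) :
    VectorField.mlieBracket 𝓘(ℝ, E) X (fun y ↦ J y (Y y)) x
        = J x (VectorField.mlieBracket 𝓘(ℝ, E) X Y x)
      ↔ chartDeriv X x (Complex.I • v) = Complex.I • chartDeriv X x v := by
  subst hv
  let u : E := X x
  let v : E := Y x
  have h1 : J x (VectorField.mlieBracket 𝓘(ℝ, E) X Y x) =
      (Complex.I • (chartDeriv Y x u - chartDeriv X x v) : E) := by
    rw [mlieBracket_eq_chartDeriv]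
    rfl
  have h2 : VectorField.mlieBracket 𝓘(ℝ, E) X (fun y ↦ J y (Y y)) x =
      (chartDeriv (fun y ↦ J y (Y y)) x u - chartDeriv X x (Complex.I • v) : E) :=
    mlieBracket_eq_chartDeriv
  rw [chartDeriv_J hY] at h2
  rw [h1, h2, smul_sub]
  exact sub_right_inj

theorem CommutesJ.mlieBracket_J (hX : CommutesJ X x) (hY : MDiffField Y x) :
    VectorField.mlieBracket 𝓘(ℝ, E) X (fun y ↦ J y (Y y)) x
      = J x (VectorField.mlieBracket 𝓘(ℝ, E) X Y x) :=
  (mlieBracket_J_eq_iff hY rfl).2 (hX _)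

theorem commutesJ_of_mlieBracket_J (h : ∀ Y : Π x : M, TangentSpace 𝓘(ℝ, E) x, SmoothAt Y x →
    VectorField.mlieBracket 𝓘(ℝ, E) X (fun y ↦ J y (Y y)) x
      = J x (VectorField.mlieBracket 𝓘(ℝ, E) X Y x)) : CommutesJ X x := by
  intro v
  let w : TangentSpace 𝓘(ℝ, E) x := v
  have hs := smoothAt_extend w
  exact (mlieBracket_J_eq_iff (mdifferentiableAt_of_smoothAt hs)
    (FiberBundle.extend_apply_self E w).symm).1 (h _ hs)

/-- If `L_X J` and `L_Y J` vanish near `x`, so does `L_{[X,Y]} J` at `x`. -/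
theorem mlieBracket_mlieBracket_J [CompleteSpace E] (hX : ∀ y, CommutesJ X y) (hY : ∀ y, CommutesJ Y y)
    (sX : SmoothAt X x) (sY : SmoothAt Y x) (sZ : SmoothAt Z x) :
    VectorField.mlieBracket 𝓘(ℝ, E) (VectorField.mlieBracket 𝓘(ℝ, E) X Y) (fun y ↦ J y (Z y)) x
      = J x (VectorField.mlieBracket 𝓘(ℝ, E) (VectorField.mlieBracket 𝓘(ℝ, E) X Y) Z x) := by
  have two {W : Π x : M, TangentSpace 𝓘(ℝ, E) x} (hW : SmoothAt W x) :
      ContMDiffAt 𝓘(ℝ, E) 𝓘(ℝ, E).tangent (minSmoothness ℝ 2)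
        (fun y ↦ (⟨y, W y⟩ : TangentBundle 𝓘(ℝ, E) M)) x :=
    ContMDiffAt.of_le hW (by simpa using WithTop.coe_le_coe.2 (le_top (a := (2 : ℕ∞))))
  have hZe : ∀ᶠ y in 𝓝 x, MDiffField Z y := by
    have : ContMDiffAt 𝓘(ℝ, E) 𝓘(ℝ, E).tangent 1
        (fun y ↦ (⟨y, Z y⟩ : TangentBundle 𝓘(ℝ, E) M)) x := ContMDiffAt.of_le sZ (by simp)
    filter_upwards [(contMDiffAt_iff_contMDiffAt_nhds (by simp)).1 this] with y hy
    exact hy.mdifferentiableAt (by simp)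
  -- Needed on a neighbourhood, because the outer bracket differentiates the inner one.
  have hc {W : Π x : M, TangentSpace 𝓘(ℝ, E) x} (hW : ∀ y, CommutesJ W y) :
      VectorField.mlieBracket 𝓘(ℝ, E) W (fun y ↦ J y (Z y)) =ᶠ[𝓝 x]
        fun y ↦ J y (VectorField.mlieBracket 𝓘(ℝ, E) W Z y) := by
    filter_upwards [hZe] with y hy using (hW y).mlieBracket_J hy
  have hr {V W : Π x : M, TangentSpace 𝓘(ℝ, E) x} (hV : ∀ y, CommutesJ V y)
      (hW : ∀ y, CommutesJ W y) (sW : SmoothAt W x) : VectorField.mlieBracket 𝓘(ℝ, E) V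
        (VectorField.mlieBracket 𝓘(ℝ, E) W (fun y ↦ J y (Z y))) x
        = J x (VectorField.mlieBracket 𝓘(ℝ, E) V (VectorField.mlieBracket 𝓘(ℝ, E) W Z) x) := by
    refine (Filter.EventuallyEq.mlieBracket_vectorField_eq (Filter.EventuallyEq.refl _ _)
      (hc hW)).trans ?_
    exact (hV x).mlieBracket_J (mdifferentiableAt_of_smoothAt (smoothAt_mlieBracket sW sZ))
  -- The Jacobi identity is applied to `Z` and to `JZ`; pulling `J` out of the two iterated brackets
  -- and comparing leaves the claim.
  have e1 := VectorField.leibniz_identity_mlieBracket_apply (two sX) (two sY) (two sZ)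
  have e2 := VectorField.leibniz_identity_mlieBracket_apply (two sX) (two sY) (two (smoothAt_J sZ))
  rw [hr hX hY sY, hr hY hX sX, e1, map_add] at e2
  exact (add_right_cancel e2).symm

end Fields

/-! ### Poisson algebra and quasi-symbols. -/

namespace KaehlerStructure

section Algebra

variable [IsManifold 𝓘(ℂ, E) ω M] (K : KaehlerStructure E M)
  {X Y Z : Π x : M, TangentSpace 𝓘(ℝ, E) x} {x : M}

theorem eq_of_metric_eq {v v' : TangentSpace 𝓘(ℝ, E) x}
    (h : ∀ w, K.metric.inner x v w = K.metric.inner x v' w) : v = v' := by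
  rw [← sub_eq_zero]
  by_contra hne
  have hp := K.metric.pos x _ hne
  have h1 : K.metric.inner x (v - v') (v - v')
      = K.metric.inner x v (v - v') - K.metric.inner x v' (v - v') := by
    rw [(K.metric.inner x).map_sub]
    rfl
  rw [h1, h, sub_self] at hp
  exact lt_irrefl _ hp

theorem form_swap (v w : TangentSpace 𝓘(ℝ, E) x) : K.form x v w = -K.form x w v := by
  change K.metric.inner x (J x v) w = -K.metric.inner x (J x w) v
  rw [← K.metric_J x (J x v) w, J_J, map_neg, neg_apply, K.metric.symm]

theorem form_J (v w : TangentSpace 𝓘(ℝ, E) x) :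
    K.form x v (J x w) = K.metric.inner x v w :=
  K.metric_J x v w

omit [IsManifold 𝓘(ℂ, E) ω M] in
theorem contMDiffAt_two (f : SmoothFun E M) (x : M) : ContMDiffAt 𝓘(ℝ, E) 𝓘(ℝ, ℝ) 2 f x :=
  (f.contMDiff x).of_le (WithTop.coe_le_coe.2 (le_top (a := (2 : ℕ∞))))

omit [IsManifold 𝓘(ℂ, E) ω M] in
theorem dirDeriv_neg (X : Π x : M, TangentSpace 𝓘(ℝ, E) x) (f : M → ℝ) (x : M) :
    dirDeriv X (fun y ↦ -f y) x = -dirDeriv X f x := by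
  have h : mfderiv 𝓘(ℝ, E) 𝓘(ℝ, ℝ) (-f) x = -mfderiv 𝓘(ℝ, E) 𝓘(ℝ, ℝ) f x := mfderiv_neg
  exact congrArg (fun L : E →L[ℝ] ℝ ↦ L (X x)) h

theorem metric_J_left (v w : TangentSpace 𝓘(ℝ, E) x) :
    K.metric.inner x (J x v) w = K.form x v w := rfl

variable [FiniteDimensional ℂ E]

theorem mdiffField_hamiltonianField (f : SmoothFun E M) (x : M) :
    MDiffField (K.hamiltonianField f) x :=
  mdifferentiableAt_of_smoothAt (K.smoothAt_hamiltonianField f x)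

/-- Hamiltonian vector fields preserve the symplectic form. -/
theorem dirDeriv_form (f : SmoothFun E M) (hY : SmoothAt Y x) (hZ : SmoothAt Z x) :
    dirDeriv (K.hamiltonianField f) (fun y ↦ K.form y (Y y) (Z y)) x =
      K.form x (VectorField.mlieBracket 𝓘(ℝ, E) (K.hamiltonianField f) Y x) (Z x)
      + K.form x (Y x) (VectorField.mlieBracket 𝓘(ℝ, E) (K.hamiltonianField f) Z x) := by
  have h := K.closed x (K.hamiltonianField f) Y Z (K.smoothAt_hamiltonianField f x) hY hZ
  change dirDeriv (K.hamiltonianField f) (fun y ↦ K.form y (Y y) (Z y)) x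
    + dirDeriv Y (fun y ↦ K.form y (Z y) (K.hamiltonianField f y)) x
    + dirDeriv Z (fun y ↦ K.form y (K.hamiltonianField f y) (Y y)) x
    - K.form x (VectorField.mlieBracket 𝓘(ℝ, E) (K.hamiltonianField f) Y x) (Z x)
    - K.form x (VectorField.mlieBracket 𝓘(ℝ, E) Y Z x) (K.hamiltonianField f x)
    - K.form x (VectorField.mlieBracket 𝓘(ℝ, E) Z (K.hamiltonianField f) x) (Y x) = 0 at h
  -- The terms of `dΩ(X_f, Y, Z)` containing `Ω(X_f, ·) = df` amount, up to sign, to `d(df)(Y, Z)`,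
  -- and so cancel.
  have h1 : (fun y ↦ K.form y (Z y) (K.hamiltonianField f y)) = fun y ↦ -dirDeriv Z f y := by
    funext y
    rw [form_swap, form_hamiltonianField]
    rfl
  have h2 : (fun y ↦ K.form y (K.hamiltonianField f y) (Y y)) = dirDeriv Y f := by
    funext y
    rw [form_hamiltonianField]
    rfl
  have h3 : K.form x (VectorField.mlieBracket 𝓘(ℝ, E) Y Z x) (K.hamiltonianField f x)
      = -(dirDeriv Y (dirDeriv Z f) x - dirDeriv Z (dirDeriv Y f) x) := by
    rw [form_swap, form_hamiltonianField, ← dirDeriv_mlieBracket (contMDiffAt_two f x)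
      (mdifferentiableAt_of_smoothAt hY) (mdifferentiableAt_of_smoothAt hZ)]
    rfl
  have h4 : K.form x (VectorField.mlieBracket 𝓘(ℝ, E) Z (K.hamiltonianField f) x) (Y x)
      = K.form x (Y x) (VectorField.mlieBracket 𝓘(ℝ, E) (K.hamiltonianField f) Z x) := by
    rw [form_swap, VectorField.mlieBracket_swap_apply, map_neg, neg_neg]
  rw [h1, h2, h3, h4, dirDeriv_neg] at h
  linarith

theorem poisson_apply (f g : SmoothFun E M) (x : M) : K.poisson f g x =
    K.form x (K.hamiltonianField f x) (K.hamiltonianField g x) :=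
  rfl

theorem poisson_eq_neg_dirDeriv (f g : SmoothFun E M) :
    (K.poisson f g : M → ℝ) = fun x ↦ -dirDeriv (K.hamiltonianField f) g x := by
  funext x
  rw [poisson_apply, form_swap, form_hamiltonianField]
  rfl

/-- The Hamiltonian vector field of a Poisson bracket is minus the Lie bracket. -/
theorem hamiltonianField_poisson (f g : SmoothFun E M) : K.hamiltonianField (K.poisson f g) =
    -VectorField.mlieBracket 𝓘(ℝ, E) (K.hamiltonianField f) (K.hamiltonianField g) := by
  funext x
  symm
  apply K.eq_hamiltonianField
  intro w
  have hw := smoothAt_extend w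
  -- With `W` extending `w`, this reads `X_f(W g) = Ω([X_f, X_g], w) + [X_f, W] g`, hence `Ω([X_f,
  -- X_g], w) = W(X_f g) = -W{f,g}`.
  have h := K.dirDeriv_form f (K.smoothAt_hamiltonianField g x) hw
  have h1 : (fun y ↦ K.form y (K.hamiltonianField g y) (FiberBundle.extend E w y))
      = dirDeriv (FiberBundle.extend E w) g := by
    funext y
    rw [form_hamiltonianField]
    rfl
  have h2 := dirDeriv_mlieBracket (contMDiffAt_two g x) (K.mdiffField_hamiltonianField f x)
    (mdifferentiableAt_of_smoothAt hw)
  have h3 : dirDeriv (FiberBundle.extend E w) (K.poisson f g) x = differential (K.poisson f g) x w := by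
    rw [dirDeriv, FiberBundle.extend_apply_self]
  rw [h1, form_hamiltonianField, FiberBundle.extend_apply_self] at h
  rw [Pi.neg_apply, map_neg, neg_apply, ← h3, poisson_eq_neg_dirDeriv, dirDeriv_neg]
  change dirDeriv _ _ x = _ + dirDeriv _ _ x at h
  linarith

theorem poisson_swap (f g : SmoothFun E M) : K.poisson f g = -K.poisson g f := by
  ext x
  exact K.form_swap _ _

theorem poisson_self (f : SmoothFun E M) : K.poisson f f = 0 := by
  ext x
  have h : K.poisson f f x = -K.poisson f f x := K.form_swap _ _
  exact self_eq_neg.1 h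

/-- Since `{f,g} = -X_f g`, the identity says that `X_{{f,g}} = -[X_f, X_g]` acts on `h` as minus
the commutator of `X_f` and `X_g`. -/
theorem poisson_jacobi (f g h : SmoothFun E M) : K.poisson f (K.poisson g h)
    + K.poisson g (K.poisson h f) + K.poisson h (K.poisson f g) = 0 := by
  rw [K.poisson_swap h f, map_neg, K.poisson_swap h]
  ext x
  change K.poisson f (K.poisson g h) x + -K.poisson g (K.poisson f h) x
    + -K.poisson (K.poisson f g) h x = 0
  have hb := dirDeriv_mlieBracket (contMDiffAt_two h x) (K.mdiffField_hamiltonianField f x)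
    (K.mdiffField_hamiltonianField g x)
  simp only [poisson_eq_neg_dirDeriv, dirDeriv_neg]
  have hc : dirDeriv (K.hamiltonianField (K.poisson f g)) h x = -dirDeriv (VectorField.mlieBracket
      𝓘(ℝ, E) (K.hamiltonianField f) (K.hamiltonianField g)) h x := by
    rw [hamiltonianField_poisson, dirDeriv, Pi.neg_apply, map_neg]
    rfl
  rw [poisson_eq_neg_dirDeriv] at hc
  rw [hc, hb]
  ring

/-- The Hamiltonian field of a quasi-symbol preserves the complex structure. -/
theorem IsQuasiSymbol.commutesJ {f : SmoothFun E M} (hf : K.IsQuasiSymbol f) (x : M) :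
    CommutesJ (K.hamiltonianField f) x := by
  refine commutesJ_of_mlieBracket_J fun Y hY ↦ K.eq_of_metric_eq fun w ↦ ?_
  have hw := smoothAt_extend w
  -- The Killing equation is tested on `JY` because `G(JY, W) = Ω(Y, W)`; comparison with the
  -- invariance of `Ω` gives `[X_f, JY] = J[X_f, Y]`.
  have h1 := hf x _ _ (smoothAt_J hY) hw
  have h2 := K.dirDeriv_form f hY hw
  simp only [lieDerivBilin, FiberBundle.extend_apply_self] at h1 h2
  change dirDeriv (K.hamiltonianField f)
    (fun y ↦ K.form y (Y y) (FiberBundle.extend E w y)) x - _ - K.form x _ _ = 0 at h1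
  rw [h2] at h1
  rw [metric_J_left]
  linarith

/-- A function is a quasi-symbol as soon as its Hamiltonian field preserves the complex
structure. -/
theorem isQuasiSymbol_of_mlieBracket_J {f : SmoothFun E M}
    (hf : ∀ (x : M) (Y : Π x : M, TangentSpace 𝓘(ℝ, E) x), SmoothAt Y x →
      VectorField.mlieBracket 𝓘(ℝ, E) (K.hamiltonianField f) (fun y ↦ J y (Y y)) x
        = J x (VectorField.mlieBracket 𝓘(ℝ, E) (K.hamiltonianField f) Y x)) :
    K.IsQuasiSymbol f := by
  intro x Y Z hY hZ
  have h := K.dirDeriv_form f hY (smoothAt_J hZ)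
  simp only [form_J] at h
  rw [hf x Z hZ, form_J] at h
  rw [lieDerivBilin, h]
  ring

/-- Preservation of `J` passes to brackets, unlike the Killing equation read directly it needs no
derivative of `G`, and for Hamiltonian fields it is equivalent to being Killing. -/
theorem IsQuasiSymbol.poisson {f g : SmoothFun E M} (hf : K.IsQuasiSymbol f)
    (hg : K.IsQuasiSymbol g) : K.IsQuasiSymbol (K.poisson f g) := by
  have : CompleteSpace E := FiniteDimensional.complete ℂ E
  refine K.isQuasiSymbol_of_mlieBracket_J fun x Y hY ↦ ?_
  have hsf := K.smoothAt_hamiltonianField f x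
  have hsg := K.smoothAt_hamiltonianField g x
  have hb := mdifferentiableAt_of_smoothAt (smoothAt_mlieBracket hsf hsg)
  have hn : K.hamiltonianField (K.poisson f g) = (-1 : ℝ) •
      VectorField.mlieBracket 𝓘(ℝ, E) (K.hamiltonianField f) (K.hamiltonianField g) := by
    rw [hamiltonianField_poisson, neg_one_smul]
  rw [hn, VectorField.mlieBracket_const_smul_left hb, VectorField.mlieBracket_const_smul_left hb,
    mlieBracket_mlieBracket_J (hf.commutesJ K) (hg.commutesJ K) hsf hsg hY, map_smul]

/-- If the Hamiltonian field of a quasi-symbol is the gradient of `g`, then its square length has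
vanishing differential. -/
theorem IsQuasiSymbol.differential_metric_eq_zero {f g : SmoothFun E M} (hf : K.IsQuasiSymbol f)
    (hg : ∀ x w, K.metric.inner x (K.hamiltonianField f x) w = differential g x w) (x : M) :
    differential (E := E)
      (fun y ↦ K.metric.inner y (K.hamiltonianField f y) (K.hamiltonianField f y)) x = 0 := by
  refine ContinuousLinearMap.ext fun w ↦ ?_
  have hw := smoothAt_extend w
  -- Since `X_f` is the gradient of `g`, the Killing equation on `(X_f, W)` reads `X_f(W g) - [X_f,
  -- W] g = 0`, that is `W(X_f g) = 0`, and `X_f g` is the square length.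
  have h := hf x _ _ (K.smoothAt_hamiltonianField f x) hw
  have hb := dirDeriv_mlieBracket (contMDiffAt_two g x) (K.mdiffField_hamiltonianField f x)
    (mdifferentiableAt_of_smoothAt hw)
  have h0 : VectorField.mlieBracket 𝓘(ℝ, E) (K.hamiltonianField f) (K.hamiltonianField f) x = 0 :=
    mlieBracket_self
  simp only [lieDerivBilin, hg, h0, map_zero, zero_apply, sub_zero] at h
  change dirDeriv _ (dirDeriv _ _) x - dirDeriv _ _ x = 0 at h
  rw [hb] at h
  have h1 : dirDeriv (FiberBundle.extend E w) (dirDeriv (K.hamiltonianField f) g) x = 0 := by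
    linarith
  rw [dirDeriv, FiberBundle.extend_apply_self] at h1
  simp only [hg]
  exact h1

end Algebra

end KaehlerStructure

/-! ### Real and holomorphic vector fields. -/

section Holomorphic

variable [IsManifold 𝓘(ℂ, E) ω M] {x y : M}

/-- The real vector field with the same chart components as a field of `(1,0)`-vectors. -/
def toReal (v : Π x : M, TangentSpace 𝓘(ℂ, E) x) (x : M) : TangentSpace 𝓘(ℝ, E) x :=
  (v x : E)

/-- The transition maps are holomorphic, so their real derivatives are their complex ones with
scalars restricted; both tangent bundles have the same coordinate changes. -/
theorem coord_toReal (v : Π x : M, TangentSpace 𝓘(ℂ, E) x) (hy : y ∈ (chartAt E x).source) :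
    (trivializationAt E (TangentSpace 𝓘(ℂ, E)) x ⟨y, v y⟩).2 = coord (toReal v) x y := by
  have h := hasFDerivWithinAt_tangentCoordChange (I := 𝓘(ℂ, E)) (x := y) (y := x) (z := y)
    (by simp [hy])
  have h3 := (h.restrictScalars ℝ).fderivWithin (by simp [uniqueDiffWithinAt_univ])
  rw [coord]
  simp only [TangentBundle.trivializationAt_apply]
  exact (congrArg (fun L : E →L[ℝ] E ↦ L (v y)) h3).symm

theorem differentiableOn_chartField {v : Π x : M, TangentSpace 𝓘(ℂ, E) x}
    (hv : v ∈ HolomorphicVectorField E M) (x : M) :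
    DifferentiableOn ℂ (chartField (toReal v) x) (chartAt E x).target := by
  intro z hz
  have hs := (chartAt E x).map_target hz
  have h1 := ((trivializationAt E (TangentSpace 𝓘(ℂ, E)) x).mdifferentiableAt_section_iff
    𝓘(ℂ, E) v hs).1 (hv _)
  have h2 : MDifferentiableAt 𝓘(ℂ, E) 𝓘(ℂ, E) (extChartAt 𝓘(ℂ, E) x).symm z := by
    have := mdifferentiableWithinAt_extChartAt_symm (I := 𝓘(ℂ, E)) (x := x) (z := z) (by simpa using hz)
    simpa [mdifferentiableWithinAt_univ] using this
  have h3 := MDifferentiableAt.comp z (I' := 𝓘(ℂ, E)) h1 h2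
  have h4 := h3.differentiableAt
  refine (h4.congr_of_eventuallyEq ?_).differentiableWithinAt
  filter_upwards [(chartAt E x).open_target.mem_nhds hz] with w hw
  exact (coord_toReal v ((chartAt E x).map_target hw)).symm

theorem mdifferentiableAt_of_chartField {v : Π x : M, TangentSpace 𝓘(ℂ, E) x}
    (h : DifferentiableAt ℂ (chartField (toReal v) x) (extChartAt 𝓘(ℝ, E) x x)) :
    MDifferentiableAt 𝓘(ℂ, E) 𝓘(ℂ, E).tangent
      (fun x ↦ (⟨x, v x⟩ : TangentBundle 𝓘(ℂ, E) M)) x := by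
  rw [mdifferentiableAt_section]
  have h1 : MDifferentiableAt 𝓘(ℂ, E) 𝓘(ℂ, E) (extChartAt 𝓘(ℂ, E) x) x :=
    mdifferentiableAt_extChartAt (mem_chart_source E x)
  have h2 := MDifferentiableAt.comp x (I' := 𝓘(ℂ, E)) h.mdifferentiableAt h1
  refine h2.congr_of_eventuallyEq ?_
  filter_upwards [(chartAt E x).open_source.mem_nhds (mem_chart_source E x)] with y hy
  exact (coord_toReal v hy).trans (coord_comp_extChartAt hy).symm

/-- A differentiable real vector field preserving the complex structure is holomorphic. -/
theorem differentiableAt_complex_of_commutesJ {X : Π x : M, TangentSpace 𝓘(ℝ, E) x}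
    (hd : MDiffField X x) (hX : CommutesJ X x) :
    DifferentiableAt ℂ (chartField X x) (extChartAt 𝓘(ℝ, E) x x) := by
  have h := mdiffField_iff.1 hd
  rw [differentiableAt_iff_restrictScalars ℝ h]
  refine ⟨⟨⟨(chartDeriv X x).toLinearMap.toAddHom, fun c v ↦ ?_⟩, (chartDeriv X x).cont⟩, rfl⟩
  change chartDeriv X x (c • v) = c • chartDeriv X x v
  have h1 : ∀ w : E, c • w = c.re • w + c.im • (Complex.I • w) := fun w ↦ by
    conv_lhs => rw [← Complex.re_add_im c, add_smul, mul_smul]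
    rfl
  rw [h1 v, h1, map_add, map_smul, map_smul, hX]

end Holomorphic

/-! ### Functions with vanishing differential. -/

section LocallyConstant

theorem isLocallyConstant_of_differential_eq_zero [IsManifold 𝓘(ℝ, E) 1 M] {f : M → ℝ}
    (hf : MDifferentiable 𝓘(ℝ, E) 𝓘(ℝ, ℝ) f) (h0 : ∀ x, differential (E := E) f x = 0) :
    IsLocallyConstant f := by
  rw [IsLocallyConstant.iff_eventually_eq]
  intro x
  obtain ⟨r, hr, hb⟩ := Metric.mem_nhds_iff.1 (target_mem_nhds (E := E) (x := x))
  have hd : ∀ z ∈ Metric.ball (extChartAt 𝓘(ℝ, E) x x) r,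
      HasFDerivAt (f ∘ (extChartAt 𝓘(ℝ, E) x).symm) (0 : E →L[ℝ] ℝ) z := by
    intro z hz
    have h1 : MDifferentiableAt 𝓘(ℝ, E) 𝓘(ℝ, E) (extChartAt 𝓘(ℝ, E) x).symm z := by
      have := mdifferentiableWithinAt_extChartAt_symm (I := 𝓘(ℝ, E)) (x := x) (z := z)
        (by simpa using hb hz)
      simpa [mdifferentiableWithinAt_univ] using this
    have h2 := (hf ((extChartAt 𝓘(ℝ, E) x).symm z)).hasMFDerivAt.comp z h1.hasMFDerivAt
    have h3 : mfderiv 𝓘(ℝ, E) 𝓘(ℝ, ℝ) f ((extChartAt 𝓘(ℝ, E) x).symm z) = 0 := h0 _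
    rw [h3, ContinuousLinearMap.zero_comp] at h2
    exact h2.hasFDerivAt
  have hc : ∀ z ∈ Metric.ball (extChartAt 𝓘(ℝ, E) x x) r,
      f ((extChartAt 𝓘(ℝ, E) x).symm z) = f x := by
    intro z hz
    have h := (convex_ball (extChartAt 𝓘(ℝ, E) x x) r).is_const_of_fderivWithin_eq_zero (𝕜 := ℝ)
      (fun w hw ↦ (hd w hw).differentiableAt.differentiableWithinAt)
      (fun w hw ↦ (hd w hw).hasFDerivWithinAt.fderivWithin
        (Metric.isOpen_ball.uniqueDiffWithinAt hw)) hz (Metric.mem_ball_self hr)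
    simpa using h
  filter_upwards [extChartAt_source_mem_nhds (I := 𝓘(ℝ, E)) x,
    (continuousAt_extChartAt (I := 𝓘(ℝ, E)) x).preimage_mem_nhds (Metric.ball_mem_nhds _ hr)]
    with y hy hyb
  rw [← hc _ hyb, (extChartAt 𝓘(ℝ, E) x).left_inv hy]

theorem differential_eq_zero_of_forall_le {f : M → ℝ} {x : M} (hf : ∀ y, f y ≤ f x) :
    differential (E := E) f x = 0 := by
  rw [differential]
  by_cases hd : MDifferentiableAt 𝓘(ℝ, E) 𝓘(ℝ, ℝ) f x
  · rw [hd.mfderiv, ModelWithCorners.range_eq_univ, fderivWithin_univ]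
    apply IsLocalMax.fderiv_eq_zero
    refine Filter.Eventually.of_forall fun z ↦ ?_
    change f _ ≤ f ((extChartAt 𝓘(ℝ, E) x).symm (extChartAt 𝓘(ℝ, E) x x))
    rw [extChartAt_to_inv]
    exact hf _
  -- The derivative is zero by convention where it does not exist.
  · exact mfderiv_zero_of_not_mdifferentiableAt hd

end LocallyConstant

/-! ### Finite-dimensionality by the Schwarz lemma. -/

namespace KaehlerStructure

section Finiteness

variable [IsManifold 𝓘(ℂ, E) ω M] (K : KaehlerStructure E M)

/-- The Riemannian length of a tangent vector. -/
def length (x : M) (v : TangentSpace 𝓘(ℝ, E) x) : ℝ :=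
  √(K.metric.inner x v v)

theorem eq_zero_of_length_le_zero {x : M} {v : TangentSpace 𝓘(ℝ, E) x} (h : K.length x v ≤ 0) :
    v = 0 := by
  by_contra hv
  exact (Real.sqrt_pos.2 (K.metric.pos x v hv)).not_ge h

/-- In the trivialization at `p`, the Riemannian length is comparable to the norm of the model
space. -/
theorem exists_length_comparison (p : M) : ∃ C > 0, ∀ᶠ y in 𝓝 p,
    ∀ X : Π x : M, TangentSpace 𝓘(ℝ, E) x,
      ‖coord X p y‖ ≤ C * K.length y (X y) ∧ K.length y (X y) ≤ C * ‖coord X p y‖ := by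
  -- With this structure the fibre norm is `length`.
  let : Bundle.RiemannianBundle (fun x : M ↦ TangentSpace 𝓘(ℝ, E) x) :=
    ⟨K.metric.toRiemannianMetric⟩
  have : IsContinuousRiemannianBundle E (fun x : M ↦ TangentSpace 𝓘(ℝ, E) x) :=
    ⟨⟨K.metric.inner, K.metric.contMDiff.continuous, fun _ _ _ ↦ rfl⟩⟩
  have hlen : ∀ (y : M) (w : TangentSpace 𝓘(ℝ, E) y), K.length y w = ‖w‖ := by
    intro y w
    rw [norm_eq_sqrt_real_inner]
    rfl
  obtain ⟨C₁, h₁, hC₁⟩ := eventually_norm_trivializationAt_lt E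
    (fun x : M ↦ TangentSpace 𝓘(ℝ, E) x) p
  obtain ⟨C₂, h₂, hC₂⟩ := eventually_norm_symmL_trivializationAt_lt E
    (fun x : M ↦ TangentSpace 𝓘(ℝ, E) x) p
  refine ⟨max C₁ C₂, by positivity, ?_⟩
  filter_upwards [hC₁, hC₂, (chartAt E p).open_source.mem_nhds (mem_chart_source E p)]
    with y hy₁ hy₂ hy X
  rw [hlen]
  constructor
  · rw [coord_eq_continuousLinearMapAt hy]
    refine (ContinuousLinearMap.le_opNorm _ _).trans ?_
    gcongr
    exact hy₁.le.trans (le_max_left _ _)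
  · conv_lhs => rw [← symmL_coord (X := X) hy]
    refine (ContinuousLinearMap.le_opNorm _ _).trans ?_
    gcongr
    exact hy₂.le.trans (le_max_right _ _)

/-- By the Schwarz lemma, a holomorphic field vanishing at `p` is, near `p`, at most half as long
as globally. -/
theorem exists_nhds_length_le_half (p : M) : ∃ W ∈ 𝓝 p, ∀ v ∈ HolomorphicVectorField E M,
    v p = 0 → ∀ S, 0 ≤ S → (∀ x, K.length x (toReal v x) ≤ S) →
      ∀ x ∈ W, K.length x (toReal v x) ≤ S / 2 := by
  obtain ⟨C, hC, hU⟩ := K.exists_length_comparison p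
  have h2 : Filter.Tendsto (extChartAt 𝓘(ℝ, E) p).symm (𝓝 (extChartAt 𝓘(ℝ, E) p p)) (𝓝 p) := by
    have := continuousAt_extChartAt_symm (I := 𝓘(ℝ, E)) p
    rwa [ContinuousAt, extChartAt_to_inv] at this
  obtain ⟨r, hr, hb⟩ := Metric.mem_nhds_iff.1
    (Filter.inter_mem (target_mem_nhds (E := E) (x := p)) (h2.eventually hU))
  -- On the `r`-ball the coordinates are bounded by `C * S`, so Schwarz bounds them by `C * S / r`
  -- times the distance to the centre. Returning to lengths costs another `C`; distance below `r /
  -- (2 * C ^ 2)` yields `S / 2`. The radius does not depend on `v`.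
  have hδ : 0 < min r (r / (2 * C ^ 2)) := by positivity
  refine ⟨_, Filter.inter_mem (Filter.inter_mem hU (extChartAt_source_mem_nhds (I := 𝓘(ℝ, E)) p))
    ((continuousAt_extChartAt (I := 𝓘(ℝ, E)) p).preimage_mem_nhds (Metric.ball_mem_nhds _ hδ)), ?_⟩
  rintro v hv hvp S hS hbound x ⟨⟨hxU, hxs⟩, hxb⟩
  rw [Set.mem_preimage, Metric.mem_ball, lt_min_iff] at hxb
  have h0 : chartField (toReal v) p (extChartAt 𝓘(ℝ, E) p p) = 0 := by
    rw [chartField_self]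
    exact hvp
  have hs := Complex.dist_le_div_mul_dist_of_mapsTo_ball (R₂ := C * S)
    ((differentiableOn_chartField hv p).mono fun z hz ↦ (hb hz).1) (fun z hz ↦ by
      rw [h0, mem_closedBall_zero_iff]
      refine ((hb hz).2 (toReal v)).1.trans ?_
      gcongr
      exact hbound _) (Metric.mem_ball.2 hxb.1)
  rw [h0, dist_zero_right, coord_comp_extChartAt (by simpa using hxs)] at hs
  calc K.length x (toReal v x) ≤ C * ‖coord (toReal v) p x‖ := (hxU _).2
    _ ≤ C * (C * S / r * (r / (2 * C ^ 2))) := by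
      gcongr
      refine hs.trans ?_
      gcongr
      exact hxb.2.le
    _ = S / 2 := by field_simp

theorem bddAbove_length [CompactSpace M] {v : Π x : M, TangentSpace 𝓘(ℂ, E) x}
    (hv : v ∈ HolomorphicVectorField E M) :
    BddAbove (Set.range fun x ↦ K.length x (toReal v x)) := by
  rw [← Set.image_univ]
  refine isCompact_univ.induction_on (p := fun s ↦ BddAbove ((fun x ↦ K.length x (toReal v x)) '' s))
    (by simp) (fun s t hst ht ↦ ht.mono (Set.image_mono hst))
    (fun s t hs ht ↦ by rw [Set.image_union]; exact hs.union ht) fun p _ ↦ ?_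
  obtain ⟨C, hC, hU⟩ := K.exists_length_comparison p
  have hc : ContinuousAt (chartField (toReal v) p) (extChartAt 𝓘(ℝ, E) p p) :=
    ((differentiableOn_chartField hv p).differentiableAt target_mem_nhds).continuousAt
  have hc2 : ContinuousAt (fun y ↦ ‖chartField (toReal v) p (extChartAt 𝓘(ℝ, E) p y)‖) p :=
    (hc.comp (continuousAt_extChartAt p)).norm
  have hc3 := hc2.eventually_lt_const (lt_add_one _)
  rw [nhdsWithin_univ]
  refine ⟨_, Filter.inter_mem (Filter.inter_mem hU hc3)
    (extChartAt_source_mem_nhds (I := 𝓘(ℝ, E)) p), ?_⟩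
  refine ⟨C * (‖chartField (toReal v) p (extChartAt 𝓘(ℝ, E) p p)‖ + 1), ?_⟩
  rintro _ ⟨y, ⟨⟨hyU, hyc⟩, hys⟩, rfl⟩
  refine (hyU _).2.trans ?_
  gcongr
  rw [← coord_comp_extChartAt (by simpa using hys)]
  exact hyc.le

include K in
/-- The space of holomorphic vector fields on a compact manifold is finite-dimensional. -/
theorem finiteDimensional_holomorphicVectorField [FiniteDimensional ℂ E] [CompactSpace M]
    [Nonempty M] : FiniteDimensional ℂ (HolomorphicVectorField E M) := by
  choose W hW hhalf using K.exists_nhds_length_le_half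
  obtain ⟨t, -, ht⟩ := isCompact_univ.elim_nhds_subcover W fun p _ ↦ hW p
  -- A field vanishing at the centres of a finite cover by the sets `W p` has supremal length `S ≤ S
  -- / 2`, hence is zero.
  let ev : HolomorphicVectorField E M →ₗ[ℂ] (t → E) :=
    { toFun := fun v p ↦ (v : Π x : M, TangentSpace 𝓘(ℂ, E) x) p
      map_add' := fun _ _ ↦ rfl
      map_smul' := fun _ _ ↦ rfl }
  refine FiniteDimensional.of_injective ev ((injective_iff_map_eq_zero ev).2 fun v hv ↦ ?_)
  have hb := K.bddAbove_length v.2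
  set S := ⨆ x, K.length x (toReal (v : Π x : M, TangentSpace 𝓘(ℂ, E) x) x) with hSdef
  have hle : ∀ x, K.length x (toReal (v : Π x : M, TangentSpace 𝓘(ℂ, E) x) x) ≤ S :=
    fun x ↦ le_ciSup hb x
  have hS : 0 ≤ S := Real.iSup_nonneg fun x ↦ Real.sqrt_nonneg _
  have hS2 : S ≤ S / 2 := ciSup_le fun x ↦ by
    obtain ⟨p, hp, hx⟩ := Set.mem_iUnion₂.1 (ht (Set.mem_univ x))
    exact hhalf p v v.2 (congrFun hv ⟨p, hp⟩) S hS hle x hx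
  ext x
  exact K.eq_zero_of_length_le_zero ((hle x).trans (by linarith))

end Finiteness

end KaehlerStructure

/-- A totally real subspace has real dimension at most the complex dimension of the whole space. -/
theorem finrank_le_of_totallyReal {V : Type*} [AddCommGroup V] [Module ℂ V] [FiniteDimensional ℂ V]
    (S : Submodule ℝ V) (hS : ∀ v ∈ S, ∀ w ∈ S, v = Complex.I • w → v = 0) :
    Module.finrank ℝ S ≤ Module.finrank ℂ V := by
  have : FiniteDimensional ℝ V := FiniteDimensional.complexToReal V
  let e : V ≃ₗ[ℝ] V := (LinearEquiv.smulOfNeZero ℂ V Complex.I Complex.I_ne_zero).restrictScalars ℝ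
  -- `S` and `iS` are independent, of equal dimension, inside a space of real dimension twice the
  -- complex one.
  have hd : Disjoint S (S.map (e : V →ₗ[ℝ] V)) := by
    rw [Submodule.disjoint_def]
    rintro v hv ⟨w, hw, rfl⟩
    exact hS _ hv w hw rfl
  have h1 := Submodule.finrank_add_finrank_le_of_disjoint hd
  have h2 : Module.finrank ℝ (S.map (e : V →ₗ[ℝ] V)) = Module.finrank ℝ S := e.finrank_map_eq S
  rw [h2, finrank_real_of_complex] at h1
  omega

/-! ### The map `σ` and the dimension bounds. -/

namespace KaehlerStructure

section QuasiSymbols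

variable [IsManifold 𝓘(ℂ, E) ω M] [FiniteDimensional ℂ E] (K : KaehlerStructure E M)

/-- The holomorphic vector field whose real part is the Hamiltonian field of a quasi-symbol. -/
def holomorphicField : K.quasiSymbols →ₗ[ℝ] HolomorphicVectorField E M where
  -- The factor `2` cancels the `1 / 2` in `realPart`. Holomorphy follows because `2 X_f` is the
  -- Hamiltonian field of the quasi-symbol `2 f`.
  toFun f := ⟨fun x ↦ ((2 : ℝ) • (id (K.hamiltonianField (f : SmoothFun E M) x) : E)), fun x ↦ by
    refine mdifferentiableAt_of_chartField ?_
    have h : toReal (fun x ↦ ((2 : ℝ) • (id (K.hamiltonianField (f : SmoothFun E M) x) : E)))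
        = K.hamiltonianField (((2 : ℝ) • f : K.quasiSymbols) : SmoothFun E M) :=
      (K.hamiltonianField_smul 2 f).symm
    rw [h]
    exact differentiableAt_complex_of_commutesJ (K.mdiffField_hamiltonianField _ x)
      (IsQuasiSymbol.commutesJ K ((2 : ℝ) • f).2 x)⟩
  map_add' f g := by
    ext x
    have h := congrFun (K.hamiltonianField_add (f : SmoothFun E M) g) x
    exact (congrArg (fun w : E ↦ (2 : ℝ) • w) h).trans (smul_add (A := E) _ _ _)
  map_smul' c f := by
    ext x
    have h := congrFun (K.hamiltonianField_smul c (f : SmoothFun E M)) x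
    exact (congrArg (fun w : E ↦ (2 : ℝ) • w) h).trans
      (smul_comm (2 : ℝ) c (id (K.hamiltonianField (f : SmoothFun E M) x) : E))

theorem holomorphicField_apply (f : K.quasiSymbols) (x : M) :
    (K.holomorphicField f : Π x : M, TangentSpace 𝓘(ℂ, E) x) x =
      ((2 : ℝ) • (id (K.hamiltonianField (f : SmoothFun E M) x) : E)) := rfl

theorem realPart_holomorphicField (f : K.quasiSymbols) (x : M) :
    realPart (K.holomorphicField f : Π x : M, TangentSpace 𝓘(ℂ, E) x) x
      = K.hamiltonianField (f : SmoothFun E M) x := by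
  have h (v : E) : (1 / 2 : ℝ) • (2 : ℝ) • v = v := by rw [smul_smul]; norm_num
  exact h _

theorem hamiltonianField_eq_zero_iff [ConnectedSpace M] (f : SmoothFun E M) :
    K.hamiltonianField f = 0 ↔ ∃ c : ℝ, ∀ x : M, f x = c := by
  constructor
  · intro h
    have h0 : ∀ x, differential (E := E) f x = 0 := fun x ↦ by
      refine ContinuousLinearMap.ext fun w ↦ ?_
      rw [← K.form_hamiltonianField, h, Pi.zero_apply, map_zero]
    obtain ⟨x₀⟩ := (inferInstance : Nonempty M)
    exact ⟨f x₀, fun x ↦ (isLocallyConstant_of_differential_eq_zero f.mdifferentiable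
      h0).apply_eq_of_preconnectedSpace x x₀⟩
  · rintro ⟨c, hc⟩
    funext x
    refine (K.eq_hamiltonianField fun w ↦ ?_).symm
    have h0 : differential (E := E) f x = 0 :=
      differential_eq_zero_of_forall_le fun y ↦ (by rw [hc, hc])
    rw [h0, Pi.zero_apply, map_zero]

theorem holomorphicField_eq_zero_iff [ConnectedSpace M] (f : K.quasiSymbols) :
    K.holomorphicField f = 0 ↔ ∃ c : ℝ, ∀ x : M, (f : SmoothFun E M) x = c := by
  rw [← hamiltonianField_eq_zero_iff K]
  constructor
  · intro h
    funext x
    rw [← realPart_holomorphicField, h]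
    exact smul_zero (A := E) _
  · intro h
    ext x
    rw [holomorphicField_apply, h]
    exact smul_zero (A := E) _

/-- On a compact connected manifold, a Killing Hamiltonian field which is a gradient vanishes. -/
theorem IsQuasiSymbol.hamiltonianField_eq_zero [CompactSpace M] [ConnectedSpace M]
    {f g : SmoothFun E M} (hf : K.IsQuasiSymbol f)
    (hg : ∀ x w, K.metric.inner x (K.hamiltonianField f x) w = differential g x w) :
    K.hamiltonianField f = 0 := by
  set h : M → ℝ := fun y ↦ K.metric.inner y (K.hamiltonianField f y) (K.hamiltonianField f y)
    with hdef
  have h0 : ∀ x, differential (E := E) h x = 0 := hf.differential_metric_eq_zero K hg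
  have hd : MDifferentiable 𝓘(ℝ, E) 𝓘(ℝ, ℝ) h := by
    have he : h = dirDeriv (K.hamiltonianField f) g := by
      funext x
      exact hg x _
    rw [he]
    exact fun x ↦ mdifferentiableAt_dirDeriv (contMDiffAt_two g x)
      (K.mdiffField_hamiltonianField f x)
  -- At a maximum of `g` its gradient `X_f` vanishes, so the constant square length is zero.
  obtain ⟨x₀, -, hx₀⟩ := isCompact_univ.exists_isMaxOn (Set.univ_nonempty (α := M))
    g.contMDiff.continuous.continuousOn
  have hz : h x₀ = 0 := by
    have := differential_eq_zero_of_forall_le (E := E) (f := g) (x := x₀) fun y ↦ hx₀ (Set.mem_univ y)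
    change K.metric.inner _ _ _ = 0
    rw [hg, this]
    rfl
  funext x
  by_contra hne
  have hp := K.metric.pos x _ hne
  have := (isLocallyConstant_of_differential_eq_zero hd h0).apply_eq_of_preconnectedSpace x x₀
  rw [hz] at this
  exact hp.ne' this

/-- The fields of quasi-symbols form a totally real subspace. -/
theorem holomorphicField_eq_zero_of_eq_I_smul [CompactSpace M] [ConnectedSpace M]
    {f g : K.quasiSymbols} (h : K.holomorphicField f = Complex.I • K.holomorphicField g) :
    K.holomorphicField f = 0 := by
  have hJ : ∀ x, K.hamiltonianField (f : SmoothFun E M) x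
      = J x (K.hamiltonianField (g : SmoothFun E M) x) := by
    intro x
    have h1 : ((2 : ℝ) • (id (K.hamiltonianField (f : SmoothFun E M) x) : E))
        = Complex.I • ((2 : ℝ) • (id (K.hamiltonianField (g : SmoothFun E M) x) : E)) :=
      congrFun (congrArg Subtype.val h) x
    rw [smul_comm] at h1
    exact smul_right_injective E (two_ne_zero (α := ℝ)) h1
  rw [holomorphicField_eq_zero_iff, ← hamiltonianField_eq_zero_iff K]
  refine IsQuasiSymbol.hamiltonianField_eq_zero K (g := g) f.2 fun x w ↦ ?_
  rw [hJ, metric_J_left, form_hamiltonianField]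

theorem const_mem_quasiSymbols [ConnectedSpace M] (c : ℝ) :
    (ContMDiffMap.const c : SmoothFun E M) ∈ K.quasiSymbols := by
  intro x Y Z _ _
  rw [(K.hamiltonianField_eq_zero_iff (ContMDiffMap.const c)).2 ⟨c, fun _ ↦ rfl⟩]
  simp [lieDerivBilin, dirDeriv, VectorField.mlieBracket_zero_left]

/-- Evaluation of quasi-symbols at a point. -/
def eval (x : M) : K.quasiSymbols →ₗ[ℝ] ℝ where
  toFun f := (f : SmoothFun E M) x
  map_add' _ _ := rfl
  map_smul' _ _ := rfl

/-- Evaluation at one point detects the constants, which are all that `σ` loses. -/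
theorem eq_zero_of_holomorphicField_eq_zero [ConnectedSpace M] {f : K.quasiSymbols} {x : M}
    (h : K.holomorphicField f = 0) (hx : K.eval x f = 0) : f = 0 := by
  obtain ⟨c, hc⟩ := (K.holomorphicField_eq_zero_iff f).1 h
  ext y
  exact ((hc y).trans (hc x).symm).trans hx

variable [CompactSpace M] [ConnectedSpace M]

theorem finiteDimensional_quasiSymbols : FiniteDimensional ℝ K.quasiSymbols := by
  have := K.finiteDimensional_holomorphicVectorField
  have : FiniteDimensional ℝ (HolomorphicVectorField E M) := FiniteDimensional.complexToReal _
  obtain ⟨x⟩ := (inferInstance : Nonempty M)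
  refine FiniteDimensional.of_injective (K.holomorphicField.prod (K.eval x))
    ((injective_iff_map_eq_zero _).2 fun f hf ↦ ?_)
  exact K.eq_zero_of_holomorphicField_eq_zero (congrArg Prod.fst hf) (congrArg Prod.snd hf)

theorem one_le_finrank_quasiSymbols : 1 ≤ Module.finrank ℝ K.quasiSymbols := by
  have := K.finiteDimensional_quasiSymbols
  obtain ⟨x⟩ := (inferInstance : Nonempty M)
  have hne : (⟨_, K.const_mem_quasiSymbols 1⟩ : K.quasiSymbols) ≠ 0 := fun h ↦
    one_ne_zero (α := ℝ) (congrArg (K.eval x) h)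
  have : Nontrivial K.quasiSymbols := ⟨_, _, hne⟩
  exact Module.finrank_pos

/-- Rank-nullity for `σ`: the image is totally real, and evaluation at a point embeds the kernel in
`ℝ`. -/
theorem finrank_quasiSymbols_le : Module.finrank ℝ K.quasiSymbols
    ≤ Module.finrank ℂ (HolomorphicVectorField E M) + 1 := by
  have := K.finiteDimensional_quasiSymbols
  have := K.finiteDimensional_holomorphicVectorField
  obtain ⟨x⟩ := (inferInstance : Nonempty M)
  rw [← K.holomorphicField.finrank_range_add_finrank_ker]
  refine add_le_add (finrank_le_of_totallyReal _ ?_) ?_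
  · rintro _ ⟨f, rfl⟩ _ ⟨g, rfl⟩ h
    exact K.holomorphicField_eq_zero_of_eq_I_smul h
  · have h := LinearMap.finrank_le_finrank_of_injective
      (f := (K.eval x).domRestrict (LinearMap.ker K.holomorphicField))
      ((injective_iff_map_eq_zero _).2 fun f hf ↦
        Subtype.ext (K.eq_zero_of_holomorphicField_eq_zero f.2 hf))
    rwa [Module.finrank_self] at h

end QuasiSymbols

end KaehlerStructure

end Kaehler

end

theorem proposition3p1 {E : Type*} [NormedAddCommGroup E] [NormedSpace ℂ E]
    [FiniteDimensional ℂ E] {M : Type*} [TopologicalSpace M] [T2Space M] [CompactSpace M]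
    [ConnectedSpace M] [ChartedSpace E M] [IsManifold 𝓘(ℂ, E) ω M]
    (K : Kaehler.KaehlerStructure E M) :
    -- the Poisson bracket makes the quasi-symbols a Lie algebra
    (∀ f ∈ K.quasiSymbols, ∀ g ∈ K.quasiSymbols, K.poisson f g ∈ K.quasiSymbols) ∧
    (∀ f, K.poisson f f = 0) ∧
    (∀ f g h, K.poisson f (K.poisson g h) + K.poisson g (K.poisson h f)
      + K.poisson h (K.poisson f g) = 0) ∧
    -- it is finite-dimensional, with the stated bounds
    FiniteDimensional ℝ K.quasiSymbols ∧
    FiniteDimensional ℂ (Kaehler.HolomorphicVectorField E M) ∧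
    1 ≤ Module.finrank ℝ K.quasiSymbols ∧
    Module.finrank ℝ K.quasiSymbols
      ≤ Module.finrank ℂ (Kaehler.HolomorphicVectorField E M) + 1 ∧
    -- the map to holomorphic vector fields, injective modulo constants
    ∃ σ : K.quasiSymbols →ₗ[ℝ] Kaehler.HolomorphicVectorField E M,
      (∀ (f : K.quasiSymbols) (x : M),
        Kaehler.realPart (σ f : Π x : M, TangentSpace 𝓘(ℂ, E) x) x
          = K.hamiltonianField (f : Kaehler.SmoothFun E M) x) ∧
      ∀ f : K.quasiSymbols, σ f = 0 ↔ ∃ c : ℝ, ∀ x : M, (f : Kaehler.SmoothFun E M) x = c := by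
  exact ⟨fun f hf g hg ↦ Kaehler.KaehlerStructure.IsQuasiSymbol.poisson K hf hg, K.poisson_self,
    K.poisson_jacobi, K.finiteDimensional_quasiSymbols, K.finiteDimensional_holomorphicVectorField,
    K.one_le_finrank_quasiSymbols, K.finrank_quasiSymbols_le, K.holomorphicField,
    K.realPart_holomorphicField, K.holomorphicField_eq_zero_iff⟩
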